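/- Let $X,Y$ be real Hilbert spaces, identified with their duals, and give $X\times Y$ the Hilbert norm $\|(u,v)\|^2=\|u\|^2+\|v\|^2$. Let $G:X\to\mathbb R\cup\{+\infty\}$ and $F:Y\to\mathbb R\cup\{+\infty\}$ be proper, convex and lower semicontinuous with $\operatorname{int}\operatorname{dom}G\neq\emptyset$ and $\operatorname{int}\operatorname{dom}F\neq\emptyset$, and let $K:X\to Y$ be Fréchet differentiable with locally Lipschitz derivative $K'$. Let $F^*(p)=\sup_{y\in Y}\langle p,y\rangle-F(y)$ be strongly convex with constant $\gamma_{F^*}>0$, i.e. $F^*(v')-F^*(v)\ge\langle z,v'-v\rangle+\frac{\gamma_{F^*}}2\|v'-v\|^2$ for all $v,v'\in Y$ and $z\in\partial F^*(v)$. For $b\in X$ define the set-valued map $$H_b(u,v)=\begin{pmatrix}\partial G(u)+K'(b)^*v\\ \partial F^*(v)-K'(b)u-c_b\end{pmatrix},\qquad c_b=K(b)-K'(b)b .$$ Let $R>0$ and let $\hat q=(\hat u,\hat v)$ satisfy $0\in H_{\hat u}(\hat q)$ and $\|\hat q\|\le R/2$. Let $L_2$ be a Lipschitz constant of $K'$ on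 the closed ball $\{\|u\|\le R\}\subset X$. *Step lengths.* Let $\mu\in[0,\gamma_{F^*})$ and $N\in\mathbb N$, and let $\sigma_0,\tau_0>0$ satisfy $\sigma_0\tau_0\sup_{\|u\|\le R}\|K'(u)\|^2<1$. Put $$\sigma_{i+1}=\omega_i\sigma_i,\qquad \tau_{i+1}=\tau_i/\omega_i,\qquad \omega_i=\begin{cases}1/\sqrt{1+2\mu\sigma_i},& i<N,\\ 1,& i\ge N,\end{cases}$$ so that $\sigma_i=\sigma_N$, $\tau_i=\tau_N$ for $i>N$. Let $\theta,\Theta>0$ be such that $$\theta^2\,\mathrm{Id}\le\begin{pmatrix}\tau_i^{-1}\mathrm{Id}&-K'(b)^*\\-K'(b)&\sigma_i^{-1}\mathrm{Id}\end{pmatrix}\le\Theta^2\,\mathrm{Id}\qquad\text{for all } i\ge0 \text{ and all } b\in X,\ \|b\|\le R,$$ and put $\kappa=\Theta/\theta$. *Metric regularity.* Suppose that $H_{\hat u}$ is metrically regular at $0$ for $\hat q$: its graph is locally closed and there are $\rho,\delta',\ell>0$ with $$\inf_{p:\,w\in H_{\hat u}(p)}\|q-p\|\le \ell\,\operatorname{dist}(w,H_{\hat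 u}(q))\quad\text{whenever }\|q-\hat q\|\le\delta',\ \|w\|\le\rho$$ (distances to the empty set are $+\infty$). Let $\mathrm{lip}\in[0,\infty)$ be the infimum of all $\ell>0$ for which such $\rho,\delta'$ exist, and suppose that $$\mathrm{lip}\,\kappa\,L_2\|\hat v\|<1-\frac1{\sqrt{1+1/(2\,\mathrm{lip}^2\,\Theta^4)}},$$ where the right-hand side is read as $1$ if $\mathrm{lip}=0$. *Conclusion.* Let the dual proximal step lengths be either $s_i=\sigma_i$ for all $i$ or $s_i=\sigma_{i+1}$ for all $i$. Then there is $\delta>0$ such that for every $q^0=(u^0,v^0)\in X\times Y$ with $\|q^0-\hat q\|\le\delta$ the accelerated nonlinear primal-dual extragradient method $$u^{i+1}=\mathrm{prox}_{\tau_iG}\big(u^i-\tau_iK'(u^i)^*v^i\big),\quad \bar u^{i+1}=u^{i+1}+\omega_i(u^{i+1}-u^i),\quad v^{i+1}=\mathrm{prox}_{s_iF^*}\big(v^i+s_iK(\bar u^{i+1})\big),$$ where $\mathrm{prox}_{tf}(x)=\arg\min_w\frac12\|w-x\|^2+t f(w)$, can be carried out, and its iterates $q^i=(u^i,v^i)$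 converge in norm to some $q^*=(u^*,v^*)\in X\times Y$ solving the optimality system $$K(u^*)\in\partial F^*(v^*),\qquad -K'(u^*)^*v^*\in\partial G(u^*).$$ -/

import Mathlib

open Filter Topology Metric
open scoped NNReal ENNReal

namespace NonlinearPD

/-! ### Extended-real-valued convex functions on a real Hilbert space -/

section ConvexAnalysis

variable {E : Type*} [NormedAddCommGroup E] [InnerProductSpace ℝ E]

/-- The effective domain. -/
def effDom (f : E → EReal) : Set E := {x | f x < ⊤}

/-- `f` is a proper, convex, lower semicontinuous function with values in `ℝ ∪ {+∞}`. Convexity is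
convexity of the epigraph. -/
structure IsProperConvexLsc (f : E → EReal) : Prop where
  ne_bot : ∀ x, f x ≠ ⊥
  dom_nonempty : (effDom f).Nonempty
  convex : Convex ℝ {p : E × ℝ | f p.1 ≤ (p.2 : EReal)}
  lsc : LowerSemicontinuous f

/-- The Fenchel conjugate `f*(p) = sup_y ⟨p, y⟩ - f(y)`, with the dual space identified with `E`. -/
noncomputable def fenchelConj (f : E → EReal) (p : E) : EReal :=
  ⨆ y : E, ((inner ℝ p y : ℝ) : EReal) - f y

/-- The convex subdifferential. -/
def subdiff (f : E → EReal) (x : E) : Set E :=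
  {z | ∀ y : E, f x + ((inner ℝ z (y - x) : ℝ) : EReal) ≤ f y}

/-- Strong convexity with constant `γ`:
`f v' - f v ≥ ⟨z, v' - v⟩ + (γ / 2) ‖v' - v‖²` for all `v`, `v'` and all `z ∈ ∂f(v)`. -/
def IsStronglyConvex (γ : ℝ) (f : E → EReal) : Prop :=
  ∀ v v' z : E, z ∈ subdiff f v →
    f v + ((inner ℝ z (v' - v) + γ / 2 * ‖v' - v‖ ^ 2 : ℝ) : EReal) ≤ f v'

/-- `w = prox_{τ f}(v)`, i.e. `w` is a minimizer of `w ↦ ‖w - v‖² / 2 + τ f(w)`. -/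
def IsProx (f : E → EReal) (τ : ℝ) (v w : E) : Prop :=
  ∀ w' : E, ((‖w - v‖ ^ 2 / 2 : ℝ) : EReal) + (τ : EReal) * f w ≤
    ((‖w' - v‖ ^ 2 / 2 : ℝ) : EReal) + (τ : EReal) * f w'

end ConvexAnalysis

/-! ### Metric regularity of set-valued maps -/

section MetricRegularity

variable {Q W : Type*} [PseudoEMetricSpace Q] [PseudoEMetricSpace W]

/-- `ℓ > 0` is a valid constant in the metric regularity estimate of `S` at `w₀` for `q₀`.
Distances to the empty set are `∞`. -/
def IsRegularityConstant (S : Q → Set W) (w₀ : W) (q₀ : Q) (ℓ : ℝ) : Prop :=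
  0 < ℓ ∧ ∃ ρ > (0 : ℝ), ∃ δ > (0 : ℝ), ∀ q w,
    edist q q₀ ≤ ENNReal.ofReal δ → edist w w₀ ≤ ENNReal.ofReal ρ →
      infEDist q {p | w ∈ S p} ≤ ENNReal.ofReal ℓ * infEDist w (S q)

/-- `S` is metrically regular at `w₀` for `q₀`. -/
def IsMetricallyRegular (S : Q → Set W) (w₀ : W) (q₀ : Q) : Prop :=
  IsLocallyClosed {p : Q × W | p.2 ∈ S p.1} ∧ ∃ ℓ, IsRegularityConstant S w₀ q₀ ℓ

/-- `lip S⁻¹(w₀ | q₀)`: the infimum of the valid constants in the metric regularity estimate. It is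
finite if `S` is metrically regular; it may be `0`. -/
noncomputable def lipInv (S : Q → Set W) (w₀ : W) (q₀ : Q) : ℝ≥0∞ :=
  ⨅ (ℓ : ℝ) (_ : IsRegularityConstant S w₀ q₀ ℓ), ENNReal.ofReal ℓ

end MetricRegularity

/-! ### The optimality system, the preconditioner, and the algorithm

Primal-dual pairs `q = (u, v)` live in the Hilbert space `WithLp 2 (X × Y)`. -/

section Algorithm

variable {X Y : Type*} [NormedAddCommGroup X] [InnerProductSpace ℝ X] [CompleteSpace X]
  [NormedAddCommGroup Y] [InnerProductSpace ℝ Y] [CompleteSpace Y]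

/-- The adjoint `K'(u)^*` of the Fréchet derivative. -/
noncomputable def derivAdj (K : X → Y) (u : X) : Y →L[ℝ] X :=
  ContinuousLinearMap.adjoint (fderiv ℝ K u)

/-- The critical point conditions `K(u) ∈ ∂F^*(v)`, `-K'(u)^* v ∈ ∂G(u)`. -/
def IsCriticalPoint (G : X → EReal) (F : Y → EReal) (K : X → Y) (q : WithLp 2 (X × Y)) : Prop :=
  K q.fst ∈ subdiff (fenchelConj F) q.snd ∧ -(derivAdj K q.fst q.snd) ∈ subdiff G q.fst

/-- The set-valued operator `H_b` linearized at the base point `b`: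
`H_b(u, v) = (∂G(u) + K'(b)^* v, ∂F^*(v) - K'(b) u - c_b)`, where `c_b = K(b) - K'(b) b`. -/
def opH (G : X → EReal) (F : Y → EReal) (K : X → Y) (b : X) (q : WithLp 2 (X × Y)) :
    Set (WithLp 2 (X × Y)) :=
  {w | (∃ z ∈ subdiff G q.fst, w.fst = z + derivAdj K b q.snd) ∧
    ∃ z ∈ subdiff (fenchelConj F) q.snd,
      w.snd = z - fderiv ℝ K b q.fst - (K b - fderiv ℝ K b b)}

/-- The preconditioner with base point `b` and step lengths `σ`, `τ`:
`M(u, v) = (τ⁻¹ u - K'(b)^* v, -K'(b) u + σ⁻¹ v)`. -/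
noncomputable def opM (K : X → Y) (σ τ : ℝ) (b : X) (q : WithLp 2 (X × Y)) : WithLp 2 (X × Y) :=
  WithLp.toLp 2 (τ⁻¹ • q.fst - derivAdj K b q.snd, -(fderiv ℝ K b q.fst) + σ⁻¹ • q.snd)

/-- The factor `ω_i = 1 / √(1 + 2 μ σ_i)` in the first `N` steps, and `ω_i = 1` afterwards. -/
noncomputable def accelFactor (μ : ℝ) (N i : ℕ) (σ : ℝ) : ℝ :=
  if i < N then 1 / √(1 + 2 * μ * σ) else 1

/-- Dual step lengths: `σ_{i+1} = ω_i σ_i`. -/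
noncomputable def stepσ (μ σ₀ : ℝ) (N : ℕ) : ℕ → ℝ
  | 0 => σ₀
  | i + 1 => accelFactor μ N i (stepσ μ σ₀ N i) * stepσ μ σ₀ N i

/-- The factors `ω_i` along the step lengths. -/
noncomputable def stepω (μ σ₀ : ℝ) (N i : ℕ) : ℝ :=
  accelFactor μ N i (stepσ μ σ₀ N i)

/-- Primal step lengths: `τ_{i+1} = τ_i / ω_i`. -/
noncomputable def stepτ (μ σ₀ τ₀ : ℝ) (N : ℕ) : ℕ → ℝ
  | 0 => τ₀
  | i + 1 => stepτ μ σ₀ τ₀ N i / stepω μ σ₀ N i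

/-- `q` is a sequence of iterates of the nonlinear primal-dual extragradient method with primal step
lengths `τ`, dual step lengths `σ` and extrapolation factors `ω`. -/
structure IsIterates (G : X → EReal) (F : Y → EReal) (K : X → Y) (τ σ ω : ℕ → ℝ)
    (q : ℕ → WithLp 2 (X × Y)) : Prop where
  primal : ∀ i, IsProx G (τ i)
    ((q i).fst - τ i • derivAdj K (q i).fst (q i).snd) (q (i + 1)).fst
  dual : ∀ i, IsProx (fenchelConj F) (σ i)
    ((q i).snd + σ i • K ((q (i + 1)).fst + ω i • ((q (i + 1)).fst - (q i).fst))) (q (i + 1)).snd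

end Algorithm

end NonlinearPD

/-! The acceleration lasts only `N` steps. The critical point `qh` is a fixed point of every step
map, whatever the step lengths and the extrapolation factor, and each step map is continuous there
because proximal maps are nonexpansive. So iterates starting close enough to `qh` are still close
after `N` steps (`exists_radius_isIterates`), and it suffices to treat constant step lengths with
extrapolation factor 1.

Such a step from `q` to `q'` is a perturbed proximal point step `-(M (q' - q) + e) ∈ H_u(q')`, with
`u` the primal part of `q`, `M` the preconditioner based at `û`, and `‖e‖ ≤ ε ‖q' - q‖`
(`exists_radius_isStep_inclusion`). The quantity that contracts is the `M`-distance from the iterate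
to a zero `p` of its own operator `H_u` (`exists_zero_opNorm_le`). Monotonicity gives, up to `ε`,
`‖q' - q‖_M² + ‖q' - p‖_M² ≤ ‖q - p‖_M²`. Metric regularity supplies a zero `z` of `H_u` with `‖q' -
z‖_M ≤ m ‖q' - q‖_M`, where `m ≈ ℓ Θ²`; together these bound `‖q' - z‖_M` by `ρ ‖q - p‖_M` with `ρ <
1`. Moving the base point to `u'` creates at `z` a residual of size about `L₂ ‖v̂‖ ‖q' - q‖`, and
regularity again gives a zero `p'` of `H_{u'}`, at the cost of a further `κ ℓ L₂ ‖v̂‖`. The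
smallness condition says that the sum of the two factors is below 1.

Regularity is needed for all base points near `û`, with almost the same constant. It follows from
the Lyusternik–Graves argument `exists_zero_of_lipschitz_perturbation`, since a change of base point
adds only a single-valued map with small Lipschitz constant. Geometric decay makes the iterates
Cauchy, and closed graphs make the limit critical. -/

namespace NonlinearPD

/-! ### Convex analysis: subgradients, proximal maps, conjugates -/

section ConvexAnalysis

variable {E : Type*} [NormedAddCommGroup E] [InnerProductSpace ℝ E]

/-- Testing against points `(y, a)` of the epigraph keeps all arithmetic in `ℝ` and turns membership
into an epigraph condition at `x`, which passes to limits. -/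
theorem mem_subdiff_iff {f : E → EReal} (hb : ∀ x, f x ≠ ⊥) {x z : E} :
    z ∈ subdiff f x ↔
      ∀ (y : E) (a : ℝ), f y ≤ a → f x ≤ ((a - inner ℝ z (y - x) : ℝ) : EReal) := by
  constructor
  · intro h y a hy
    have h1 := (h y).trans hy
    have hx := hb x
    induction hfx : f x with
    | bot => exact absurd hfx hx
    | top => simp [hfx] at h1
    | coe c =>
      rw [hfx] at h1
      have h2 : c + inner ℝ z (y - x) ≤ a := by exact_mod_cast h1
      exact_mod_cast by linarith
  · intro h y
    induction hfy : f y with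
    | bot => exact absurd hfy (hb y)
    | top => exact le_top
    | coe a =>
      have h1 := h y a hfy.le
      induction hfx : f x with
      | bot => exact absurd hfx (hb x)
      | top => exact absurd (top_le_iff.1 (hfx ▸ h1)) (EReal.coe_ne_top _)
      | coe c =>
        rw [hfx] at h1
        have h2 : c ≤ a - inner ℝ z (y - x) := by exact_mod_cast h1
        exact_mod_cast by linarith

namespace IsProperConvexLsc

variable {f : E → EReal} (hf : IsProperConvexLsc f)

include hf

theorem exists_coe : ∃ (x : E) (c : ℝ), f x = c := by
  obtain ⟨x, hx⟩ := hf.dom_nonempty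
  refine ⟨x, (f x).toReal, (EReal.coe_toReal (ne_of_lt hx) (hf.ne_bot x)).symm⟩

theorem exists_coe_of_mem_subdiff {x z : E} (hz : z ∈ subdiff f x) : ∃ c : ℝ, f x = c := by
  obtain ⟨y, a, hy⟩ := hf.exists_coe
  have h := (mem_subdiff_iff hf.ne_bot).1 hz y a hy.le
  refine ⟨(f x).toReal, (EReal.coe_toReal (ne_of_lt (h.trans_lt (EReal.coe_lt_top _)))
    (hf.ne_bot x)).symm⟩

theorem isClosed_epi : IsClosed {p : E × ℝ | f p.1 ≤ (p.2 : EReal)} :=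
  hf.lsc.isClosed_epigraph.preimage
    (continuous_fst.prodMk (continuous_coe_real_ereal.comp continuous_snd))

theorem subdiff_monotone {x x' z z' : E} (hz : z ∈ subdiff f x) (hz' : z' ∈ subdiff f x') :
    0 ≤ inner ℝ (z - z') (x - x') := by
  obtain ⟨c, hc⟩ := hf.exists_coe_of_mem_subdiff hz
  obtain ⟨c', hc'⟩ := hf.exists_coe_of_mem_subdiff hz'
  have h := (mem_subdiff_iff hf.ne_bot).1 hz x' c' hc'.le
  have h' := (mem_subdiff_iff hf.ne_bot).1 hz' x c hc.le
  rw [hc] at h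
  rw [hc'] at h'
  norm_cast at h h'
  simp only [inner_sub_left, inner_sub_right] at *
  linarith

theorem mem_subdiff_of_tendsto {x z : ℕ → E} {x₀ z₀ : E} (hx : Tendsto x atTop (𝓝 x₀))
    (hz : Tendsto z atTop (𝓝 z₀)) (h : ∀ n, z n ∈ subdiff f (x n)) : z₀ ∈ subdiff f x₀ := by
  rw [mem_subdiff_iff hf.ne_bot]
  intro y a hy
  have h1 : Tendsto (fun n => ((x n, a - inner ℝ (z n) (y - x n)) : E × ℝ)) atTop
      (𝓝 (x₀, a - inner ℝ z₀ (y - x₀))) :=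
    hx.prodMk_nhds (tendsto_const_nhds.sub (hz.inner (tendsto_const_nhds.sub hx)))
  exact hf.isClosed_epi.mem_of_tendsto h1
    (Eventually.of_forall fun n => (mem_subdiff_iff hf.ne_bot).1 (h n) y a hy)

theorem isProx_iff {τ : ℝ} (hτ : 0 < τ) {v w : E} :
    IsProx f τ v w ↔ ∀ (w' : E) (a : ℝ), f w' ≤ a →
      f w ≤ ((a + (‖w' - v‖ ^ 2 - ‖w - v‖ ^ 2) / (2 * τ) : ℝ) : EReal) := by
  have key : ∀ c a : ℝ, (‖w - v‖ ^ 2 / 2 + τ * c ≤ a ↔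
      c ≤ (a - ‖w - v‖ ^ 2 / 2) / τ) := fun c a => by
    rw [le_div_iff₀ hτ]; constructor <;> intro h <;> linarith
  have key2 : ∀ (a : ℝ) (w' : E), (‖w' - v‖ ^ 2 / 2 + τ * a - ‖w - v‖ ^ 2 / 2) / τ =
      a + (‖w' - v‖ ^ 2 - ‖w - v‖ ^ 2) / (2 * τ) := fun a w' => by
    field_simp; ring
  constructor
  · intro h w' a hw'
    have h1 := h w'
    induction hfw' : f w' with
    | bot => exact absurd hfw' (hf.ne_bot w')
    | top => simp [hfw'] at hw'
    | coe c' =>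
      rw [hfw'] at h1 hw'
      norm_cast at hw'
      induction hfw : f w with
      | bot => exact absurd hfw (hf.ne_bot w)
      | top =>
        rw [hfw, EReal.coe_mul_top_of_pos hτ, EReal.coe_add_top, top_le_iff] at h1
        exact absurd h1 (by norm_cast; exact EReal.coe_ne_top _)
      | coe c =>
        rw [hfw] at h1
        norm_cast at h1 ⊢
        rw [key, key2] at h1
        linarith
  · intro h w'
    induction hfw' : f w' with
    | bot => exact absurd hfw' (hf.ne_bot w')
    | top => rw [EReal.coe_mul_top_of_pos hτ, EReal.coe_add_top]; exact le_top
    | coe c' =>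
      have h1 := h w' c' hfw'.le
      induction hfw : f w with
      | bot => exact absurd hfw (hf.ne_bot w)
      | top => exact absurd (top_le_iff.1 (hfw ▸ h1)) (EReal.coe_ne_top _)
      | coe c =>
        rw [hfw] at h1
        norm_cast at h1 ⊢
        rw [key, key2]
        exact h1

/-- Fermat's rule for the proximal problem; it turns the algorithm into inclusions. -/
theorem isProx_iff_mem_subdiff {τ : ℝ} (hτ : 0 < τ) {v w : E} :
    IsProx f τ v w ↔ τ⁻¹ • (v - w) ∈ subdiff f w := by
  rw [hf.isProx_iff hτ, mem_subdiff_iff hf.ne_bot]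
  have expand : ∀ w' : E, ‖w' - v‖ ^ 2 = ‖w - v‖ ^ 2 - 2 * inner ℝ (v - w) (w' - w)
      + ‖w' - w‖ ^ 2 := fun w' => by
    have : w' - v = (w' - w) - (v - w) := by abel
    rw [this, norm_sub_sq_real, real_inner_comm, norm_sub_rev v w]; ring
  constructor
  · intro h w' a hw'
    obtain ⟨x, b, hx⟩ := hf.exists_coe
    have hw := h x b hx.le
    obtain ⟨c, hc⟩ : ∃ c : ℝ, f w = c := ⟨(f w).toReal, (EReal.coe_toReal
      (ne_of_lt (hw.trans_lt (EReal.coe_lt_top _))) (hf.ne_bot w)).symm⟩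
    rw [hc]
    rw [EReal.coe_le_coe_iff]
    -- Compare `w` with the point `w + t (w' - w)`: after division by `t` the quadratic term is of
    -- order `t` and vanishes as `t ↓ 0`.
    have hlim : Tendsto (fun t : ℝ => a - inner ℝ (τ⁻¹ • (v - w)) (w' - w)
        + t * ‖w' - w‖ ^ 2 / (2 * τ)) (𝓝[>] 0)
        (𝓝 (a - inner ℝ (τ⁻¹ • (v - w)) (w' - w) + 0 * ‖w' - w‖ ^ 2 / (2 * τ))) := by
      apply Tendsto.mono_left _ nhdsWithin_le_nhds
      apply Continuous.tendsto
      fun_prop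
    have hev : ∀ᶠ t : ℝ in 𝓝[>] 0, c ≤ a - inner ℝ (τ⁻¹ • (v - w)) (w' - w)
        + t * ‖w' - w‖ ^ 2 / (2 * τ) := by
      filter_upwards [Ioo_mem_nhdsGT (zero_lt_one' ℝ)] with t ht
      have hconv := hf.convex (x := (w, c)) hc.le (y := (w', a)) hw' (a := 1 - t) (b := t)
        (by linarith [ht.2]) ht.1.le (by ring)
      have h1 := h _ _ hconv
      rw [hc] at h1
      norm_cast at h1
      rw [expand] at h1
      have h2 : ((1 - t) • ((w, c) : E × ℝ) + t • ((w', a) : E × ℝ)).1 - w = t • (w' - w) := by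
        simp only [Prod.fst_add, Prod.smul_fst]; module
      rw [h2, norm_smul, inner_smul_right, Real.norm_of_nonneg ht.1.le] at h1
      simp only [Prod.snd_add, Prod.smul_snd, smul_eq_mul] at h1
      rw [inner_smul_left]
      simp only [conj_trivial]
      have h3 : t * c ≤ t * (a - τ⁻¹ * inner ℝ (v - w) (w' - w)
        + t * ‖w' - w‖ ^ 2 / (2 * τ)) := by
        have : (‖w - v‖ ^ 2 - 2 * (t * inner ℝ (v - w) (w' - w)) + (t * ‖w' - w‖) ^ 2 -
          ‖w - v‖ ^ 2) / (2 * τ) = t * (- (τ⁻¹ * inner ℝ (v - w) (w' - w))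
            + t * ‖w' - w‖ ^ 2 / (2 * τ)) := by
          field_simp; ring
        rw [this] at h1
        linarith
      exact le_of_mul_le_mul_left h3 ht.1
    have := ge_of_tendsto hlim hev
    simpa using this
  · intro h w' a hw'
    refine (h w' a hw').trans ?_
    rw [EReal.coe_le_coe_iff, expand, inner_smul_left]
    simp only [conj_trivial]
    have : (‖w - v‖ ^ 2 - 2 * inner ℝ (v - w) (w' - w) + ‖w' - w‖ ^ 2 - ‖w - v‖ ^ 2) / (2 * τ)
      = - (τ⁻¹ * inner ℝ (v - w) (w' - w)) + ‖w' - w‖ ^ 2 / (2 * τ) := by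
      field_simp; ring
    rw [this]
    have : 0 ≤ ‖w' - w‖ ^ 2 / (2 * τ) := by positivity
    linarith

/-- Monotonicity of the subdifferential and Cauchy–Schwarz. -/
theorem norm_sub_le_of_isProx {τ : ℝ} (hτ : 0 < τ) {v v' w w' : E} (h : IsProx f τ v w)
    (h' : IsProx f τ v' w') : ‖w - w'‖ ≤ ‖v - v'‖ := by
  have hm := hf.subdiff_monotone ((hf.isProx_iff_mem_subdiff hτ).1 h)
    ((hf.isProx_iff_mem_subdiff hτ).1 h')
  rw [← smul_sub, inner_smul_left] at hm
  have hm' := nonneg_of_mul_nonneg_right hm (by simpa using hτ)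
  have e : v - w - (v' - w') = (v - v') - (w - w') := by abel
  rw [e, inner_sub_left, real_inner_self_eq_norm_sq] at hm'
  have := real_inner_le_norm (v - v') (w - w')
  nlinarith [norm_nonneg (w - w'), norm_nonneg (v - v')]

/-- Lower semicontinuity bounds `f` below on a ball around `x₀`; pulling a far point `w` into that
ball along the segment to `x₀`, convexity allows at most linear decrease in `‖w - x₀‖`. -/
theorem exists_lower_bound : ∃ (x₀ : E) (c r : ℝ), 0 < r ∧
    ∀ (w : E) (a : ℝ), f w ≤ a → c - ‖w - x₀‖ / r ≤ a := by
  obtain ⟨x₀, c, hc⟩ := hf.exists_coe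
  have hlsc := hf.lsc x₀ ((c - 1 : ℝ) : EReal) (by
    change _ < f x₀
    rw [hc, EReal.coe_lt_coe_iff]; linarith)
  obtain ⟨r, hr, hball⟩ := Metric.eventually_nhds_iff.1 hlsc
  refine ⟨x₀, c - 1, r / 2, by positivity, fun w a hw => ?_⟩
  rcases lt_or_ge ‖w - x₀‖ r with hlt | hge
  · have h1 := (hball (y := w) (by rwa [dist_eq_norm])).trans_le hw
    norm_cast at h1
    have : 0 ≤ ‖w - x₀‖ / (r / 2) := by positivity
    linarith
  · have hn : 0 < ‖w - x₀‖ := hr.trans_le hge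
    set t := r / 2 / ‖w - x₀‖ with ht
    have ht0 : 0 < t := by positivity
    have ht1 : t ≤ 1 := by rw [ht, div_le_one hn]; linarith
    have hconv := hf.convex (x := (x₀, c)) hc.le (y := (w, a)) hw (a := 1 - t) (b := t)
        (by linarith) ht0.le (by ring)
    have h2 : ((1 - t) • ((x₀, c) : E × ℝ) + t • ((w, a) : E × ℝ)).1 - x₀ = t • (w - x₀) := by
      simp only [Prod.fst_add, Prod.smul_fst]; module
    have h3 : dist ((1 - t) • ((x₀, c) : E × ℝ) + t • ((w, a) : E × ℝ)).1 x₀ < r := by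
      rw [dist_eq_norm, h2, norm_smul, Real.norm_of_nonneg ht0.le, ht, div_mul_cancel₀ _ hn.ne']
      linarith
    have h4 := (hball h3).trans_le hconv
    simp only [Prod.snd_add, Prod.smul_snd, smul_eq_mul] at h4
    norm_cast at h4
    have h5 : ‖w - x₀‖ / (r / 2) = 1 / t := by rw [ht]; field_simp
    rw [h5]
    have h6 : t * (c - a) < 1 := by linarith
    have h7 : c - a < 1 / t := by rw [lt_div_iff₀ ht0]; linarith
    linarith

/-- The direct method on the epigraph: the quadratic term dominates the linear lower bound, the
parallelogram law makes a minimizing sequence Cauchy, and the epigraph is closed. -/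
theorem exists_isProx [CompleteSpace E] {τ : ℝ} (hτ : 0 < τ) (v : E) : ∃ w, IsProx f τ v w := by
  set J : E × ℝ → ℝ := fun p => ‖p.1 - v‖ ^ 2 / 2 + τ * p.2 with hJ
  set S : Set (E × ℝ) := {p : E × ℝ | f p.1 ≤ (p.2 : EReal)} with hS
  have hne : S.Nonempty := by
    obtain ⟨x, c, hx⟩ := hf.exists_coe
    exact ⟨(x, c), hx.le⟩
  have hbdd : BddBelow (J '' S) := by
    obtain ⟨x₀, c, r, hr, hlow⟩ := hf.exists_lower_bound
    refine ⟨τ * (c - ‖v - x₀‖ / r) - (τ / r) ^ 2 / 2, ?_⟩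
    rintro _ ⟨p, hp, rfl⟩
    have h1 := hlow p.1 p.2 hp
    have h2 : ‖p.1 - x₀‖ ≤ ‖p.1 - v‖ + ‖v - x₀‖ := norm_sub_le_norm_sub_add_norm_sub _ _ _
    have h3 : ‖p.1 - x₀‖ / r ≤ (‖p.1 - v‖ + ‖v - x₀‖) / r := by gcongr
    have h4 : τ * (c - (‖p.1 - v‖ + ‖v - x₀‖) / r) ≤ τ * p.2 := by
      gcongr; linarith
    have h5 : τ * (c - (‖p.1 - v‖ + ‖v - x₀‖) / r)
      = τ * (c - ‖v - x₀‖ / r) - (τ / r) * ‖p.1 - v‖ := by field_simp; ring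
    simp only [hJ]
    nlinarith [sq_nonneg (‖p.1 - v‖ - τ / r)]
  set I := sInf (J '' S) with hI
  have hlow : ∀ p ∈ S, I ≤ J p := fun p hp => csInf_le hbdd ⟨p, hp, rfl⟩
  have hseq : ∀ n : ℕ, ∃ p ∈ S, J p < I + 1 / ((n : ℝ) + 1) := fun n => by
    obtain ⟨_, ⟨p, hp, rfl⟩, h⟩ := exists_lt_of_csInf_lt (hne.image J)
      (lt_add_of_pos_right I (by positivity : (0 : ℝ) < 1 / ((n : ℝ) + 1)))
    exact ⟨p, hp, h⟩
  choose p hpS hpJ using hseq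
  have hmid : ∀ m n, ‖(p m).1 - (p n).1‖ ^ 2 ≤
      4 * (1 / ((m : ℝ) + 1) + 1 / ((n : ℝ) + 1)) := fun m n => by
    have hconv := hf.convex (hpS m) (hpS n) (a := 1 / 2) (b := 1 / 2)
      (by norm_num) (by norm_num) (by norm_num)
    have h1 := hlow _ hconv
    have h2 : ((1 / 2 : ℝ) • p m + (1 / 2 : ℝ) • p n).1 - v
        = (1 / 2 : ℝ) • (((p m).1 - v) + ((p n).1 - v)) := by
      simp only [Prod.fst_add, Prod.smul_fst]
      module
    have h3 := parallelogram_law_with_norm ℝ ((p m).1 - v) ((p n).1 - v)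
    rw [show (p m).1 - v - ((p n).1 - v) = (p m).1 - (p n).1 by abel] at h3
    simp only [hJ] at h1
    rw [h2, norm_smul] at h1
    simp only [Prod.snd_add, Prod.smul_snd, smul_eq_mul] at h1
    have h4 := hpJ m
    have h5 := hpJ n
    simp only [hJ] at h4 h5
    norm_num at h1
    nlinarith
  have hcau : CauchySeq fun n => (p n).1 := by
    rw [Metric.cauchySeq_iff']
    intro ε hε
    obtain ⟨n₀, hn₀⟩ := exists_nat_one_div_lt (show 0 < ε ^ 2 / 8 by positivity)
    refine ⟨n₀, fun n hn => ?_⟩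
    rw [dist_eq_norm]
    have h1 : 1 / ((n : ℝ) + 1) ≤ 1 / ((n₀ : ℝ) + 1) := by
      gcongr
    have h2 := hmid n n₀
    exact lt_of_pow_lt_pow_left₀ 2 hε.le (by linarith)
  obtain ⟨w, hw⟩ := cauchySeq_tendsto_of_complete hcau
  have hJlim : Tendsto (fun n => J (p n)) atTop (𝓝 I) := by
    refine tendsto_of_tendsto_of_tendsto_of_le_of_le tendsto_const_nhds (h := fun n : ℕ =>
      I + 1 / ((n : ℝ) + 1)) ?_ (fun n => hlow _ (hpS n)) (fun n => (hpJ n).le)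
    simpa using tendsto_const_nhds.add (tendsto_one_div_add_atTop_nhds_zero_nat (𝕜 := ℝ))
  have hsnd : Tendsto (fun n => (p n).2) atTop (𝓝 ((I - ‖w - v‖ ^ 2 / 2) / τ)) := by
    have : (fun n => (p n).2) = fun n => (J (p n) - ‖(p n).1 - v‖ ^ 2 / 2) / τ := by
      ext n; simp only [hJ]; field_simp; ring
    rw [this]
    exact (hJlim.sub ((((hw.sub_const v).norm).pow 2).div_const 2)).div_const τ
  have hmem : f w ≤ (((I - ‖w - v‖ ^ 2 / 2) / τ : ℝ) : EReal) :=
    hf.isClosed_epi.mem_of_tendsto (hw.prodMk_nhds hsnd) (Eventually.of_forall hpS)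
  refine ⟨w, (hf.isProx_iff hτ).2 fun w' a hw' => hmem.trans ?_⟩
  have h1 := hlow (w', a) hw'
  simp only [hJ] at h1
  rw [EReal.coe_le_coe_iff, div_le_iff₀ hτ]
  have : (a + (‖w' - v‖ ^ 2 - ‖w - v‖ ^ 2) / (2 * τ)) * τ
    = a * τ + (‖w' - v‖ ^ 2 - ‖w - v‖ ^ 2) / 2 := by field_simp
  rw [this]
  linarith

end IsProperConvexLsc

theorem fenchelConj_le_coe_iff {f : E → EReal} (hb : ∀ x, f x ≠ ⊥) {p : E} {a : ℝ} :
    fenchelConj f p ≤ a ↔ ∀ (y : E) (b : ℝ), f y = b → inner ℝ p y - b ≤ a := by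
  unfold fenchelConj
  rw [iSup_le_iff]
  refine forall_congr' fun y => ?_
  constructor
  · intro h b hb'
    rw [hb'] at h
    exact_mod_cast h
  · intro h
    induction hfy : f y with
    | bot => exact absurd hfy (hb y)
    | top => simp
    | coe b => exact_mod_cast h b hfy

/-- Allows the proximal theory to be applied to `F^*`. For properness, the optimality condition of a
proximal point of `0` yields a subgradient of `f`, and the conjugate is finite there. -/
theorem IsProperConvexLsc.fenchelConj [CompleteSpace E] {f : E → EReal}
    (hf : IsProperConvexLsc f) : IsProperConvexLsc (fenchelConj f) := by
  refine ⟨fun x => ?_, ?_, ?_, ?_⟩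
  · obtain ⟨y, c, hy⟩ := hf.exists_coe
    refine ne_of_gt (lt_of_lt_of_le ?_ (le_iSup _ y))
    rw [hy]
    exact_mod_cast EReal.bot_lt_coe _
  · obtain ⟨w, hw⟩ := hf.exists_isProx one_pos (0 : E)
    rw [hf.isProx_iff_mem_subdiff one_pos] at hw
    obtain ⟨c, hc⟩ := hf.exists_coe_of_mem_subdiff hw
    set z := (1 : ℝ)⁻¹ • (0 - w)
    refine ⟨z, lt_of_le_of_lt ((fenchelConj_le_coe_iff hf.ne_bot (a := inner ℝ z w - c)).2 ?_)
      (EReal.coe_lt_top _)⟩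
    intro y b hy
    have h := (mem_subdiff_iff hf.ne_bot).1 hw y b hy.le
    rw [hc] at h
    norm_cast at h
    rw [inner_sub_right] at h
    linarith
  · rintro ⟨x, a⟩ hx ⟨y, b⟩ hy s t hs ht hst
    simp only [Set.mem_ofPred_eq, fenchelConj_le_coe_iff hf.ne_bot] at hx hy ⊢
    intro w c hw
    have h1 := hx w c hw
    have h2 := hy w c hw
    simp only [Prod.fst_add, Prod.smul_fst, Prod.snd_add, Prod.smul_snd, smul_eq_mul,
      inner_add_left, inner_smul_left, conj_trivial]
    have e : s * inner ℝ x w + t * inner ℝ y w - c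
      = s * (inner ℝ x w - c) + t * (inner ℝ y w - c) := by
      linear_combination (-c) * hst.symm
    rw [e]
    gcongr
  · refine lowerSemicontinuous_iSup fun y => ?_
    induction hfy : f y with
    | bot => exact absurd hfy (hf.ne_bot y)
    | top => simpa using lowerSemicontinuous_const
    | coe b =>
      apply Continuous.lowerSemicontinuous
      norm_cast
      exact continuous_coe_real_ereal.comp (by fun_prop)

end ConvexAnalysis

theorem mul_one_sub_pow_div_le {a k : ℝ} (ha : 0 ≤ a) (hk0 : 0 ≤ k) (hk1 : k < 1) (n : ℕ) :
    a * (1 - k ^ n) / (1 - k) ≤ a / (1 - k) := by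
  have := pow_nonneg hk0 n
  exact div_le_div_of_nonneg_right (mul_le_of_le_one_right ha (by linarith)) (by linarith)

/-! ### Metric regularity under Lipschitz perturbations -/

section PerturbedRegularity

variable {Q : Type*} [NormedAddCommGroup Q]

/-- The Aubin property of the inverse, extracted from a regularity constant. -/
theorem IsRegularityConstant.exists_radius {S : Q → Set Q} {q₀ : Q} {ℓ₀ ℓ : ℝ}
    (h : IsRegularityConstant S 0 q₀ ℓ₀) (hℓ : ℓ₀ < ℓ) :
    ∃ r > 0, ∀ q w w', ‖q - q₀‖ ≤ r → ‖w'‖ ≤ r → w ∈ S q →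
      ∃ q', w' ∈ S q' ∧ ‖q - q'‖ ≤ ℓ * ‖w - w'‖ := by
  obtain ⟨h₀, ρ, hρ, δ, hδ, hreg⟩ := h
  refine ⟨min ρ δ, lt_min hρ hδ, fun q w w' hq hw' hw => ?_⟩
  -- The gap `ℓ₀ < ℓ` replaces the infimum distance by an actual point, but only when `w ≠ w'`.
  rcases eq_or_ne w w' with rfl | hne
  · exact ⟨q, hw, by simp⟩
  have hpos : 0 < ‖w - w'‖ := norm_sub_pos_iff.2 hne
  have h1 := hreg q w'
    (by rw [edist_dist, dist_eq_norm]; exact ENNReal.ofReal_le_ofReal (hq.trans (min_le_right _ _)))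
    (by
      rw [edist_dist, dist_eq_norm, sub_zero]
      exact ENNReal.ofReal_le_ofReal (hw'.trans (min_le_left _ _)))
  have h2 : infEDist w' (S q) ≤ ENNReal.ofReal ‖w - w'‖ := by
    refine (infEDist_le_edist_of_mem hw).trans ?_
    rw [edist_comm, edist_dist, dist_eq_norm]
  have h3 : infEDist q {p | w' ∈ S p} < ENNReal.ofReal (ℓ * ‖w - w'‖) := by
    refine (h1.trans (mul_le_mul_right h2 _)).trans_lt ?_
    rw [← ENNReal.ofReal_mul h₀.le]
    exact (ENNReal.ofReal_lt_ofReal_iff (by have := h₀.trans hℓ; positivity)).2 (by gcongr)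
  obtain ⟨q', hq', hlt⟩ := infEDist_lt_iff.1 h3
  refine ⟨q', hq', ?_⟩
  rw [edist_dist, dist_eq_norm] at hlt
  exact (ENNReal.ofReal_lt_ofReal_iff'.1 hlt).1.le

/-- Lyusternik–Graves: metric regularity survives single-valued perturbations with a small
Lipschitz constant. -/
theorem exists_zero_of_lipschitz_perturbation [CompleteSpace Q] {S : Q → Set Q}
    (hclosed : IsClosed {p : Q × Q | p.2 ∈ S p.1}) {q₀ : Q} {ℓ r ε : ℝ} (hℓ : 0 < ℓ) (hε : 0 ≤ ε)
    (hreg : ∀ q w w', ‖q - q₀‖ ≤ r → ‖w'‖ ≤ r → w ∈ S q →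
      ∃ q', w' ∈ S q' ∧ ‖q - q'‖ ≤ ℓ * ‖w - w'‖)
    {g : Q → Q} (hg : ∀ q q', ‖g q - g q'‖ ≤ ε * ‖q - q'‖) (hℓε : ℓ * ε < 1)
    (hgr : ∀ q, ‖q - q₀‖ ≤ r → ‖g q‖ ≤ r) {q w : Q}
    (hq : ‖q - q₀‖ + ℓ * ‖w‖ / (1 - ℓ * ε) ≤ r) (hw : w - g q ∈ S q) :
    ∃ q', -g q' ∈ S q' ∧ ‖q - q'‖ ≤ ℓ * ‖w‖ / (1 - ℓ * ε) := by
  -- Iteration for a zero of `S + g`: given `-g x ∈ S y`, regularity solves `-g y ∈ S z` with `z`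
  -- near `y`. The hypotheses stand after `∃ z` so that `choose` yields a total function; increments
  -- then shrink by `k = ℓ ε`.
  have hstep : ∀ x y : Q, ∃ z, (‖y - q₀‖ ≤ r → -g x ∈ S y →
      -g y ∈ S z ∧ ‖y - z‖ ≤ ℓ * ‖g y - g x‖) := by
    intro x y
    by_cases h : ‖y - q₀‖ ≤ r ∧ -g x ∈ S y
    · obtain ⟨z, hz, hyz⟩ := hreg y _ (-g y) h.1 (by rw [norm_neg]; exact hgr y h.1) h.2
      refine ⟨z, fun _ _ => ⟨hz, ?_⟩⟩
      rwa [show -g x - -g y = g y - g x by abel] at hyz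
    · exact ⟨y, fun h1 h2 => absurd ⟨h1, h2⟩ h⟩
  choose F hF using hstep
  set k := ℓ * ε with hk
  have hk0 : 0 ≤ k := by positivity
  have hk1 : 0 < 1 - k := by linarith
  have hq₀ : ‖q - q₀‖ ≤ r := le_trans (le_add_of_nonneg_right (by positivity)) hq
  obtain ⟨x₁, hx₁, hqx₁⟩ := hreg q _ (-g q) hq₀ (by rw [norm_neg]; exact hgr q hq₀) hw
  rw [show w - g q - -g q = w by abel] at hqx₁
  set st : ℕ → Q × Q := fun n => Nat.rec (q, x₁) (fun _ s => (s.2, F s.1 s.2)) n with hst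
  set x : ℕ → Q := fun n => (st n).1 with hx
  have hx0 : x 0 = q := rfl
  have hxone : x 1 = x₁ := rfl
  have hxs : ∀ n, x (n + 2) = F (x n) (x (n + 1)) := fun n => rfl
  set a := ℓ * ‖w‖ with ha
  have ha0 : 0 ≤ a := by positivity
  have inv : ∀ n, -g (x n) ∈ S (x (n + 1)) ∧ ‖x n - x (n + 1)‖ ≤ a * k ^ n ∧
      ‖q - x n‖ ≤ a * (1 - k ^ n) / (1 - k) := by
    intro n
    induction n with
    | zero => exact ⟨hx₁, by rw [zero_add, hxone, hx0]; simpa using hqx₁, by simp [hx0]⟩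
    | succ n ih =>
      obtain ⟨h1, h2, h3⟩ := ih
      have h4 : ‖q - x (n + 1)‖ ≤ a * (1 - k ^ (n + 1)) / (1 - k) := by
        refine (norm_sub_le_norm_sub_add_norm_sub _ (x n) _).trans ((add_le_add h3 h2).trans ?_)
        apply le_of_eq
        field_simp
        ring
      have h5 : ‖x (n + 1) - q₀‖ ≤ r := by
        refine (norm_sub_le_norm_sub_add_norm_sub _ q _).trans ?_
        have : a * (1 - k ^ (n + 1)) / (1 - k) ≤ a / (1 - k) :=
          mul_one_sub_pow_div_le ha0 hk0 hℓε (n + 1)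
        rw [norm_sub_rev]
        linarith
      obtain ⟨h6, h7⟩ := hF _ _ h5 h1
      rw [← hxs] at h6 h7
      refine ⟨h6, h7.trans ?_, h4⟩
      calc ℓ * ‖g (x (n + 1)) - g (x n)‖ ≤ ℓ * (ε * ‖x (n + 1) - x n‖) := by
            gcongr; exact hg _ _
        _ = k * ‖x n - x (n + 1)‖ := by rw [norm_sub_rev, hk]; ring
        _ ≤ k * (a * k ^ n) := by gcongr
        _ = a * k ^ (n + 1) := by ring
  have hcau : CauchySeq x := cauchySeq_of_le_geometric k a hℓε fun n => by
    rw [dist_eq_norm]; exact (inv n).2.1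
  obtain ⟨y, hy⟩ := cauchySeq_tendsto_of_complete hcau
  have hgc : Continuous g := (LipschitzWith.of_dist_le_mul (K := ⟨ε, hε⟩) fun q q' => by
    rw [dist_eq_norm, dist_eq_norm]; exact hg q q').continuous
  refine ⟨y, ?_, ?_⟩
  · have hlim : Tendsto (fun n => (x (n + 1), -g (x n))) atTop (𝓝 (y, -g y)) :=
      (hy.comp (tendsto_add_atTop_nat 1)).prodMk_nhds ((hgc.tendsto y).comp hy).neg
    exact hclosed.mem_of_tendsto hlim (Eventually.of_forall fun n => (inv n).1)
  · refine le_of_tendsto (hy.const_sub q).norm (Eventually.of_forall fun n => (inv n).2.2.trans ?_)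
    exact mul_one_sub_pow_div_le ha0 hk0 hℓε n

end PerturbedRegularity

/-! ### One preconditioned proximal point step -/

section Preconditioner

variable {Q : Type*} [NormedAddCommGroup Q] [InnerProductSpace ℝ Q]

/-- The (semi)norm `√⟨M q, q⟩` of a positive operator. -/
noncomputable def opNorm (M : Q →ₗ[ℝ] Q) (q : Q) : ℝ := √(inner ℝ (M q) q)

/-- `M` is self-adjoint with `θ² ≤ M ≤ Θ²`. -/
structure IsPreconditioner (M : Q →ₗ[ℝ] Q) (θ Θ : ℝ) : Prop where
  symm : M.IsSymmetric
  pos : 0 < θ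
  pos' : 0 < Θ
  lower : ∀ q, θ ^ 2 * ‖q‖ ^ 2 ≤ inner ℝ (M q) q
  upper : ∀ q, inner ℝ (M q) q ≤ Θ ^ 2 * ‖q‖ ^ 2

namespace IsPreconditioner

variable {M : Q →ₗ[ℝ] Q} {θ Θ : ℝ} (hM : IsPreconditioner M θ Θ)

include hM

theorem inner_nonneg (q : Q) : 0 ≤ inner ℝ (M q) q := le_trans (by positivity) (hM.lower q)

theorem sq_opNorm (q : Q) : opNorm M q ^ 2 = inner ℝ (M q) q := Real.sq_sqrt (hM.inner_nonneg q)

theorem mul_norm_le_opNorm (q : Q) : θ * ‖q‖ ≤ opNorm M q := by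
  have := hM.pos
  apply Real.le_sqrt_of_sq_le
  rw [mul_pow]
  exact hM.lower q

theorem norm_le (q : Q) : ‖q‖ ≤ opNorm M q / θ := by
  rw [le_div_iff₀ hM.pos, mul_comm]
  exact hM.mul_norm_le_opNorm q

theorem opNorm_le (q : Q) : opNorm M q ≤ Θ * ‖q‖ := by
  have := hM.pos'
  rw [opNorm, Real.sqrt_le_left (by positivity), mul_pow]
  exact hM.upper q

theorem inner_add (p q : Q) :
    inner ℝ (M (p + q)) (p + q) = inner ℝ (M p) p + 2 * inner ℝ (M p) q + inner ℝ (M q) q := by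
  have h : inner ℝ (M q) p = inner ℝ (M p) q := by rw [hM.symm q p, real_inner_comm]
  simp only [map_add, inner_add_left, inner_add_right, h]
  ring

/-- Cauchy–Schwarz for the form of `M`, from the discriminant of `t ↦ ⟨M (p + t q), p + t q⟩ ≥ 0`.
-/
theorem inner_le_mul_opNorm (p q : Q) : inner ℝ (M p) q ≤ opNorm M p * opNorm M q := by
  have key : ∀ t : ℝ, 0 ≤ inner ℝ (M q) q * (t * t) + 2 * inner ℝ (M p) q * t
      + inner ℝ (M p) p := fun t => by
    have h := hM.inner_nonneg (p + t • q)
    rw [hM.inner_add, map_smul] at h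
    simp only [inner_smul_left, inner_smul_right, conj_trivial] at h
    linarith
  have hd := discrim_le_zero key
  rw [discrim, ← hM.sq_opNorm, ← hM.sq_opNorm] at hd
  have h : inner ℝ (M p) q ^ 2 ≤ (opNorm M p * opNorm M q) ^ 2 := by rw [mul_pow]; linarith
  exact (abs_le_of_sq_le_sq' h (mul_nonneg (Real.sqrt_nonneg _) (Real.sqrt_nonneg _))).2

theorem opNorm_add_le (p q : Q) : opNorm M (p + q) ≤ opNorm M p + opNorm M q := by
  have hp : 0 ≤ opNorm M p := Real.sqrt_nonneg _
  have hq : 0 ≤ opNorm M q := Real.sqrt_nonneg _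
  rw [opNorm, Real.sqrt_le_left (by positivity), hM.inner_add, ← hM.sq_opNorm, ← hM.sq_opNorm]
  nlinarith [hM.inner_le_mul_opNorm p q]

theorem norm_apply_le (q : Q) : ‖M q‖ ≤ Θ * opNorm M q := by
  have h1 := hM.inner_le_mul_opNorm q (M q)
  rw [real_inner_self_eq_norm_sq] at h1
  have h2 := hM.opNorm_le (M q)
  have hq : 0 ≤ opNorm M q := Real.sqrt_nonneg _
  rcases (norm_nonneg (M q)).eq_or_lt with h | h
  · rw [← h]; have := hM.pos'; positivity
  · refine le_of_mul_le_mul_right ?_ h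
    nlinarith

theorem norm_apply_le_mul_norm (q : Q) : ‖M q‖ ≤ Θ ^ 2 * ‖q‖ := by
  have := hM.pos'
  nlinarith [hM.norm_apply_le q, hM.opNorm_le q]

end IsPreconditioner

/-- One step of a preconditioned proximal point method whose monotone operator `T b` depends on the
base point `b = q`: the distance to the zeros of the operator contracts. -/
theorem exists_zero_opNorm_le {M : Q →ₗ[ℝ] Q} {θ Θ : ℝ} (hM : IsPreconditioner M θ Θ)
    {T : Q → Q → Set Q} {q₀ : Q} {ℓ Λ ε r r' m s ρ : ℝ} (hℓ : 0 < ℓ) (hΛ : 0 ≤ Λ) (hε : 0 ≤ ε)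
    (hmono : ∀ b p p' w w', w ∈ T b p → w' ∈ T b p' → 0 ≤ inner ℝ (w - w') (p - p'))
    (hreg : ∀ b q w, ‖b - q₀‖ ≤ r → ‖q - q₀‖ ≤ r → ‖w‖ ≤ r → w ∈ T b q →
      ∃ q', 0 ∈ T b q' ∧ ‖q - q'‖ ≤ ℓ * ‖w‖)
    (hlip : ∀ b b' q, ‖b - q₀‖ ≤ r → ‖b' - q₀‖ ≤ r → ‖q - q₀‖ ≤ r → 0 ∈ T b q →
      ∃ w ∈ T b' q, ‖w‖ ≤ Λ * ‖b - b'‖)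
    (hm : m = Θ * ℓ * (Θ + ε / θ)) (hs : s = 1 - ε / θ ^ 2) (hs0 : 0 < s) (hρ : 0 ≤ ρ)
    (hρ1 : 1 ≤ ρ ^ 2 * (1 + 1 / m ^ 2) * s)
    (hr : r' ≤ r) (hr1 : (Θ ^ 2 + ε) * (2 * r') ≤ r) (hr2 : r' + ℓ * ((Θ ^ 2 + ε) * (2 * r')) ≤ r)
    (hr3 : Λ * (2 * r') ≤ r)
    {q q' p e : Q} (hq : ‖q - q₀‖ ≤ r') (hq' : ‖q' - q₀‖ ≤ r') (hp : ‖p - q₀‖ ≤ r')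
    (hp0 : 0 ∈ T q p) (he : ‖e‖ ≤ ε * ‖q' - q‖) (hstep : -(M (q' - q) + e) ∈ T q q') :
    ∃ p', 0 ∈ T q' p' ∧ opNorm M (q' - p') ≤ (ρ + Θ / θ * ℓ * Λ / √s) * opNorm M (q - p) ∧
      ‖q' - q‖ ≤ 1 / (θ * √s) * opNorm M (q - p) := by
  have hθ := hM.pos
  have hΘ := hM.pos'
  have nn : ∀ x, 0 ≤ opNorm M x := fun x => Real.sqrt_nonneg _
  have hm0 : 0 < m := by rw [hm]; positivity
  set d := opNorm M (q' - q) with hd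
  set A := opNorm M (q - p) with hA
  set b' := opNorm M (q' - p) with hb'
  have hdn : ‖q' - q‖ ≤ d / θ := hM.norm_le _
  -- the descent inequality
  have hdesc : s * (d ^ 2 + b' ^ 2) ≤ A ^ 2 := by
    have h1 := hmono _ _ _ _ _ hstep hp0
    rw [sub_zero, inner_neg_left, inner_add_left] at h1
    -- Three-point identity. The cross term is controlled by monotonicity up to the contribution of
    -- `e`, which costs the factor `s = 1 - ε / θ ^ 2`.
    have h2 : inner ℝ (M (q - p)) (q - p) = inner ℝ (M (q' - q)) (q' - q)
        + 2 * inner ℝ (M (q' - q)) (-(q' - p)) + inner ℝ (M (q' - p)) (q' - p) := by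
      have := hM.inner_add (q' - q) (-(q' - p))
      simp only [map_neg, inner_neg_neg] at this
      rw [← this, ← inner_neg_neg, ← map_neg]
      congr 2 <;> abel_nf
    rw [← hM.sq_opNorm, ← hM.sq_opNorm, ← hM.sq_opNorm, inner_neg_right] at h2
    have h3 : -inner ℝ e (q' - p) ≤ (ε / θ ^ 2) * (d * b') := by
      calc -inner ℝ e (q' - p) = inner ℝ (-e) (q' - p) := by rw [inner_neg_left]
        _ ≤ ‖-e‖ * ‖q' - p‖ := real_inner_le_norm _ _
        _ ≤ (ε * (d / θ)) * (b' / θ) := by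
          rw [norm_neg]
          exact mul_le_mul (he.trans (mul_le_mul_of_nonneg_left hdn hε)) (hM.norm_le _)
            (norm_nonneg _) (mul_nonneg hε (div_nonneg (Real.sqrt_nonneg _) hθ.le))
        _ = _ := by field_simp
    have h4 : 0 ≤ ε / θ ^ 2 := by positivity
    rw [hs]
    nlinarith [sq_nonneg (d - b'), mul_nonneg h4 (sq_nonneg (d - b'))]
  have hd0 : 0 ≤ d := nn _
  have hb'0 : 0 ≤ b' := nn _
  have hA0 : 0 ≤ A := nn _
  have hdA : d ≤ A / √s := by
    rw [le_div_iff₀ (Real.sqrt_pos.2 hs0)]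
    apply (abs_le_of_sq_le_sq' _ hA0).2
    rw [mul_pow, Real.sq_sqrt hs0.le]
    nlinarith [sq_nonneg b']
  have hΔ : ‖q' - q‖ ≤ 2 * r' := by
    have := norm_sub_le_norm_sub_add_norm_sub q' q₀ q
    rw [norm_sub_rev q₀ q] at this
    linarith
  have hwn : ‖-(M (q' - q) + e)‖ ≤ (Θ ^ 2 + ε) * (2 * r') := by
    rw [norm_neg]
    refine (norm_add_le _ _).trans ?_
    have h1 := (hM.norm_apply_le_mul_norm (q' - q))
    calc _ ≤ (Θ ^ 2 + ε) * ‖q' - q‖ := by linarith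
      _ ≤ _ := by gcongr
  -- a zero of `T q` that is close to `q'`
  obtain ⟨z, hz0, hzr, hzm, hzb⟩ : ∃ z, 0 ∈ T q z ∧ ‖z - q₀‖ ≤ r ∧ opNorm M (q' - z) ≤ m * d ∧
      opNorm M (q' - z) ≤ b' := by
    -- The split yields both bounds at once: if `p` already satisfies the regularity bound, keep it;
    -- otherwise the zero from regularity is closer to `q'` than `p` is.
    by_cases hc : b' ≤ m * d
    · exact ⟨p, hp0, hp.trans hr, hc, le_rfl⟩
    · obtain ⟨z, hz0, hz⟩ := hreg q q' _ (hq.trans hr) (hq'.trans hr) (hwn.trans hr1) hstep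
      have h1 : opNorm M (q' - z) ≤ m * d := by
        calc opNorm M (q' - z) ≤ Θ * ‖q' - z‖ := hM.opNorm_le _
          _ ≤ Θ * (ℓ * ((Θ + ε / θ) * d)) := by
            gcongr
            refine hz.trans ?_
            gcongr
            rw [norm_neg]
            refine (norm_add_le _ _).trans ?_
            have h2 := hM.norm_apply_le (q' - q)
            have h3 := he.trans (mul_le_mul_of_nonneg_left hdn hε)
            calc _ ≤ Θ * d + ε * (d / θ) := add_le_add h2 h3
              _ = _ := by ring
          _ = m * d := by rw [hm]; ring
      refine ⟨z, hz0, ?_, h1, by linarith⟩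
      have h4 := norm_sub_le_norm_sub_add_norm_sub z q' q₀
      rw [norm_sub_rev z q'] at h4
      have h5 := mul_le_mul_of_nonneg_left hwn hℓ.le
      linarith
  set β := opNorm M (q' - z) with hβ
  have hβ0 : 0 ≤ β := nn _
  have hβA : β ≤ ρ * A := by
    -- Both terms of the descent inequality dominate a multiple of `β ^ 2`: `d ^ 2 ≥ β ^ 2 / m ^ 2`
    -- and `b' ^ 2 ≥ β ^ 2`.
    apply (abs_le_of_sq_le_sq' _ (by positivity)).2
    have h1 : β ^ 2 ≤ b' ^ 2 := by gcongr
    have h2 : β ^ 2 / m ^ 2 ≤ d ^ 2 := by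
      rw [div_le_iff₀ (by positivity)]
      calc β ^ 2 ≤ (m * d) ^ 2 := by gcongr
        _ = _ := by ring
    have h3 : (1 + 1 / m ^ 2) * s * β ^ 2 ≤ A ^ 2 := by
      calc (1 + 1 / m ^ 2) * s * β ^ 2 = s * (β ^ 2 / m ^ 2 + β ^ 2) := by ring
        _ ≤ s * (d ^ 2 + b' ^ 2) := by gcongr
        _ ≤ _ := hdesc
    calc β ^ 2 ≤ (ρ ^ 2 * (1 + 1 / m ^ 2) * s) * β ^ 2 := le_mul_of_one_le_left (sq_nonneg _) hρ1
      _ = ρ ^ 2 * ((1 + 1 / m ^ 2) * s * β ^ 2) := by ring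
      _ ≤ ρ ^ 2 * A ^ 2 := by gcongr
      _ = _ := by ring
  -- transport to the new base point
  obtain ⟨w, hw, hwn'⟩ := hlip q q' z (hq.trans hr) (hq'.trans hr) hzr hz0
  rw [norm_sub_rev q q'] at hwn'
  obtain ⟨p', hp'0, hp'⟩ := hreg q' z w (hq'.trans hr) hzr
    (hwn'.trans ((mul_le_mul_of_nonneg_left hΔ hΛ).trans hr3)) hw
  refine ⟨p', hp'0, ?_, ?_⟩
  · have h1 : q' - p' = (q' - z) + (z - p') := by abel
    rw [h1]
    refine (hM.opNorm_add_le _ _).trans ?_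
    have h2 : opNorm M (z - p') ≤ Θ / θ * ℓ * Λ * d := by
      calc opNorm M (z - p') ≤ Θ * ‖z - p'‖ := hM.opNorm_le _
        _ ≤ Θ * (ℓ * (Λ * (d / θ))) := by
          gcongr
          refine hp'.trans ?_
          gcongr
          refine hwn'.trans ?_
          gcongr
        _ = _ := by ring
    have h3 : Θ / θ * ℓ * Λ * d ≤ Θ / θ * ℓ * Λ * (A / √s) := by gcongr
    calc _ ≤ ρ * A + Θ / θ * ℓ * Λ * (A / √s) := add_le_add hβA (h2.trans h3)
      _ = _ := by ring
  · calc ‖q' - q‖ ≤ d / θ := hdn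
      _ ≤ A / √s / θ := by gcongr
      _ = _ := by
        have := Real.sqrt_pos.2 hs0
        field_simp

end Preconditioner

/-! ### Convergence towards a moving target -/

/-- A sequence whose distance `n (q i - p i)` to a moving target contracts, with increments
controlled by that distance, converges if it starts close to a reference point. -/
theorem exists_radius_tendsto_of_contraction {Q : Type*} [NormedAddCommGroup Q] [CompleteSpace Q]
    {n : Q → ℝ} {θ Γ c C r r₀ : ℝ} {q₀ : Q} {Z Step : Q → Q → Prop} (hr : 0 < r) (hr₀ : 0 < r₀)
    (hΓ : 0 ≤ Γ) (hc0 : 0 ≤ c) (hc1 : c < 1) (hC : 0 ≤ C) (hθ : 0 < θ)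
    (hn : ∀ x, ‖x‖ ≤ n x / θ)
    (hinit : ∀ q, ‖q - q₀‖ ≤ r₀ → ∃ p, Z q p ∧ n (q - p) ≤ Γ * ‖q - q₀‖)
    (hstep : ∀ q p q', ‖q - q₀‖ ≤ r → ‖p - q₀‖ ≤ r → Z q p → Step q q' →
      ∃ p', Z q' p' ∧ n (q' - p') ≤ c * n (q - p) ∧ ‖q' - q‖ ≤ C * n (q - p)) :
    ∃ δ > 0, ∀ q : ℕ → Q, ‖q 0 - q₀‖ ≤ δ → (∀ i, Step (q i) (q (i + 1))) →
      ∃ qs, Tendsto q atTop (𝓝 qs) ∧ ‖qs - q₀‖ ≤ r := by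
  have hc : 0 < 1 - c := by linarith
  -- Per unit of initial distance: the initial distance itself, the total length of the path, and
  -- the distance from an iterate to its target. Thus iterates and targets all stay in the ball of
  -- radius `r`.
  set D := 1 + C * Γ / (1 - c) + Γ / θ with hD
  have hD0 : 0 < D := by positivity
  refine ⟨min r₀ (r / D), by positivity, fun q hq0 hS => ?_⟩
  obtain ⟨p₀, hp₀, hA⟩ := hinit (q 0) (hq0.trans (min_le_left _ _))
  set δ := ‖q 0 - q₀‖ with hδ
  have hδr : δ * D ≤ r := by
    rw [← le_div_iff₀ hD0]; exact hq0.trans (min_le_right _ _)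
  have hδ0 : 0 ≤ δ := norm_nonneg _
  have hZ : ∀ i, ∃ p, Z (q i) p ∧ n (q i - p) ≤ Γ * δ * c ^ i ∧
      ‖q i - q₀‖ ≤ δ + C * (Γ * δ) * (1 - c ^ i) / (1 - c) ∧
      (∀ j < i, ‖q j - q (j + 1)‖ ≤ C * (Γ * δ) * c ^ j) := by
    intro i
    induction i with
    | zero => exact ⟨p₀, hp₀, by simpa using hA, by simp [hδ], by simp⟩
    | succ i ih =>
      obtain ⟨p, hp, h1, h2, h3⟩ := ih
      have hci : 0 ≤ c ^ i := pow_nonneg hc0 i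
      have hci1 : c ^ i ≤ 1 := pow_le_one₀ hc0 hc1.le
      have h4 : C * (Γ * δ) * (1 - c ^ i) / (1 - c) ≤ C * (Γ * δ) / (1 - c) :=
        mul_one_sub_pow_div_le (by positivity) hc0 hc1 i
      have h5 : C * (Γ * δ) / (1 - c) = δ * (C * Γ / (1 - c)) := by ring
      have h6 : ‖q i - q₀‖ ≤ δ + δ * (C * Γ / (1 - c)) := by linarith
      have h7 : 0 ≤ δ * (Γ / θ) := by positivity
      have h8 : ‖q i - p‖ ≤ δ * (Γ / θ) := by
        refine (hn _).trans ?_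
        calc n (q i - p) / θ ≤ Γ * δ * 1 / θ := by
              gcongr; exact h1.trans (by gcongr)
          _ = _ := by ring
      have h9 : δ * D = δ + δ * (C * Γ / (1 - c)) + δ * (Γ / θ) := by rw [hD]; ring
      have h10 : ‖p - q₀‖ ≤ r := by
        have := norm_sub_le_norm_sub_add_norm_sub p (q i) q₀
        rw [norm_sub_rev p (q i)] at this
        linarith
      obtain ⟨p', hp', h11, h12⟩ := hstep _ _ _ (by linarith) h10 hp (hS i)
      have h13 : ‖q (i + 1) - q i‖ ≤ C * (Γ * δ) * c ^ i := by
        refine h12.trans ?_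
        rw [mul_assoc]; gcongr
      refine ⟨p', hp', ?_, ?_, ?_⟩
      · refine h11.trans ?_
        calc c * n (q i - p) ≤ c * (Γ * δ * c ^ i) := by gcongr
          _ = _ := by ring
      · have := norm_sub_le_norm_sub_add_norm_sub (q (i + 1)) (q i) q₀
        calc _ ≤ C * (Γ * δ) * c ^ i + (δ + C * (Γ * δ) * (1 - c ^ i) / (1 - c)) := by linarith
          _ = _ := by field_simp; ring
      · intro j hj
        rcases Nat.lt_succ_iff_lt_or_eq.1 hj with h | rfl
        · exact h3 j h
        · rwa [norm_sub_rev]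
  have hcau : CauchySeq q := cauchySeq_of_le_geometric c (C * (Γ * δ)) hc1 fun i => by
    obtain ⟨-, -, -, -, h⟩ := hZ (i + 1)
    rw [dist_eq_norm]
    exact h i (Nat.lt_succ_self i)
  obtain ⟨qs, hqs⟩ := cauchySeq_tendsto_of_complete hcau
  refine ⟨qs, hqs, le_of_tendsto (hqs.sub_const q₀).norm (Eventually.of_forall fun i => ?_)⟩
  obtain ⟨-, -, -, h, -⟩ := hZ i
  refine h.trans (le_trans ?_ hδr)
  have hci : 0 ≤ c ^ i := pow_nonneg hc0 i
  have h4 : C * (Γ * δ) * (1 - c ^ i) / (1 - c) ≤ C * (Γ * δ) / (1 - c) :=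
    mul_one_sub_pow_div_le (by positivity) hc0 hc1 i
  have h9 : δ * D = δ + C * (Γ * δ) / (1 - c) + δ * (Γ / θ) := by rw [hD]; ring
  have h7 : 0 ≤ δ * (Γ / θ) := by positivity
  linarith

/-- Smallness requirements are strict inequalities at parameter `0`; as eventual statements,
finitely many can be met at once. -/
theorem eventually_nhdsGT_lt_of_continuousAt {f : ℝ → ℝ} {c : ℝ} (hf : ContinuousAt f 0)
    (h : f 0 < c) : ∀ᶠ x in 𝓝[>] (0 : ℝ), f x < c :=
  (hf.eventually_lt_const h).filter_mono nhdsWithin_le_nhds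

/-! ### Components in the product Hilbert space -/

section ProductSpace

theorem ext_fst_snd {X Y : Type*} {p q : WithLp 2 (X × Y)} (h₁ : p.fst = q.fst)
    (h₂ : p.snd = q.snd) : p = q :=
  WithLp.ofLp_injective 2 (Prod.ext h₁ h₂)

theorem inner_eq_fst_add_snd {X Y : Type*} [NormedAddCommGroup X] [InnerProductSpace ℝ X]
    [NormedAddCommGroup Y] [InnerProductSpace ℝ Y] (p q : WithLp 2 (X × Y)) :
    inner ℝ p q = inner ℝ p.fst q.fst + inner ℝ p.snd q.snd := rfl

variable {X Y : Type*} [NormedAddCommGroup X] [NormedAddCommGroup Y]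

theorem norm_fst_le (q : WithLp 2 (X × Y)) : ‖q.fst‖ ≤ ‖q‖ := WithLp.norm_fst_le _ q

theorem norm_snd_le (q : WithLp 2 (X × Y)) : ‖q.snd‖ ≤ ‖q‖ := WithLp.norm_snd_le _ q

theorem norm_fst_sub_le (p q : WithLp 2 (X × Y)) : ‖p.fst - q.fst‖ ≤ ‖p - q‖ := by
  rw [← WithLp.sub_fst]; exact norm_fst_le _

theorem norm_snd_sub_le (p q : WithLp 2 (X × Y)) : ‖p.snd - q.snd‖ ≤ ‖p - q‖ := by
  rw [← WithLp.sub_snd]; exact norm_snd_le _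

theorem norm_le_fst_add_snd (q : WithLp 2 (X × Y)) : ‖q‖ ≤ ‖q.fst‖ + ‖q.snd‖ := by
  refine (abs_le_of_sq_le_sq' ?_ (by positivity)).2
  rw [WithLp.prod_norm_sq_eq_of_L2]
  nlinarith [norm_nonneg q.fst, norm_nonneg q.snd]

end ProductSpace

variable {X Y : Type*} [NormedAddCommGroup X] [InnerProductSpace ℝ X] [CompleteSpace X]
  [NormedAddCommGroup Y] [InnerProductSpace ℝ Y] [CompleteSpace Y]
  {G : X → EReal} {F : Y → EReal} {K : X → Y}

/-! ### The linearized operator: change of base point, monotonicity, regularity -/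

section Lipschitz

variable {L : ℝ≥0} {R : ℝ}

theorem norm_fderiv_sub_le {X Y : Type*} [NormedAddCommGroup X] [NormedSpace ℝ X]
    [NormedAddCommGroup Y] [NormedSpace ℝ Y] {K : X → Y} (hL : LipschitzOnWith L (fderiv ℝ K) (closedBall 0 R)) {b b' : X}
    (hb : ‖b‖ ≤ R) (hb' : ‖b'‖ ≤ R) : ‖fderiv ℝ K b - fderiv ℝ K b'‖ ≤ L * ‖b - b'‖ :=
  hL.norm_sub_le (by simpa using hb) (by simpa using hb')

theorem norm_derivAdj_sub_le (hL : LipschitzOnWith L (fderiv ℝ K) (closedBall 0 R)) {b b' : X}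
    (hb : ‖b‖ ≤ R) (hb' : ‖b'‖ ≤ R) (v : Y) :
    ‖derivAdj K b v - derivAdj K b' v‖ ≤ L * ‖b - b'‖ * ‖v‖ := by
  unfold derivAdj
  rw [← sub_apply, ← map_sub]
  refine (ContinuousLinearMap.le_opNorm _ _).trans ?_
  rw [LinearIsometryEquiv.norm_map]
  gcongr
  exact norm_fderiv_sub_le hL hb hb'

theorem norm_fderiv_sub_apply_le (hL : LipschitzOnWith L (fderiv ℝ K) (closedBall 0 R)) {b b' : X}
    (hb : ‖b‖ ≤ R) (hb' : ‖b'‖ ≤ R) (u : X) :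
    ‖fderiv ℝ K b u - fderiv ℝ K b' u‖ ≤ L * ‖b - b'‖ * ‖u‖ := by
  rw [← sub_apply]
  refine (ContinuousLinearMap.le_opNorm _ _).trans ?_
  gcongr
  exact norm_fderiv_sub_le hL hb hb'

theorem norm_taylor_le (hK : Differentiable ℝ K)
    (hL : LipschitzOnWith L (fderiv ℝ K) (closedBall 0 R)) {b b' : X}
    (hb : ‖b‖ ≤ R) (hb' : ‖b'‖ ≤ R) :
    ‖K b' - K b - fderiv ℝ K b (b' - b)‖ ≤ L * ‖b' - b‖ * ‖b' - b‖ := by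
  refine Convex.norm_image_sub_le_of_norm_fderiv_le' (s := segment ℝ b b')
    (fun x _ => hK x) (fun x hx => ?_) (convex_segment b b') (left_mem_segment ℝ b b')
    (right_mem_segment ℝ b b')
  have hx' : x ∈ closedBall (0 : X) R :=
    (convex_closedBall (0 : X) R).segment_subset (by simpa using hb) (by simpa using hb') hx
  refine (norm_fderiv_sub_le hL (by simpa using hx') hb).trans ?_
  gcongr
  exact norm_sub_le_of_mem_segment hx

/-- The change of the single-valued part of `opH` when the base point moves from `b` to `b'`. -/
noncomputable def pert (K : X → Y) (b b' : X) (q : WithLp 2 (X × Y)) : WithLp 2 (X × Y) :=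
  WithLp.toLp 2 (derivAdj K b' q.snd - derivAdj K b q.snd,
    (K b + fderiv ℝ K b (q.fst - b)) - (K b' + fderiv ℝ K b' (q.fst - b')))

/-- The set-valued parts `∂G` and `∂F^*` do not depend on the base point. -/
theorem add_pert_mem_opH_iff {b b' : X} {q w : WithLp 2 (X × Y)} :
    w + pert K b b' q ∈ opH G F K b' q ↔ w ∈ opH G F K b q := by
  simp only [opH, Set.mem_ofPred_eq, pert, WithLp.add_fst, WithLp.add_snd, WithLp.toLp_fst,
    WithLp.toLp_snd, map_sub]
  refine and_congr (exists_congr fun z => and_congr_right fun _ => ?_)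
    (exists_congr fun z => and_congr_right fun _ => ?_)
  · constructor <;> intro h
    · rw [eq_sub_of_add_eq h]; abel
    · rw [h]; abel
  · constructor <;> intro h
    · rw [eq_sub_of_add_eq h]; abel
    · rw [h]; abel

/-- The adjoint part contributes `‖q.snd‖`; the difference of the two linearizations of `K` is a
Taylor remainder plus a derivative difference at `q.fst - b`. Near the solution only the first
survives, whence `L₂ ‖v̂‖` in the smallness condition. -/
theorem norm_pert_le (hK : Differentiable ℝ K)
    (hL : LipschitzOnWith L (fderiv ℝ K) (closedBall 0 R)) {b b' : X}
    (hb : ‖b‖ ≤ R) (hb' : ‖b'‖ ≤ R) (q : WithLp 2 (X × Y)) :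
    ‖pert K b b' q‖ ≤ L * ‖b - b'‖ * (‖q.snd‖ + ‖b - b'‖ + ‖q.fst - b‖) := by
  refine (norm_le_fst_add_snd _).trans ?_
  have h1 : ‖(pert K b b' q).fst‖ ≤ L * ‖b - b'‖ * ‖q.snd‖ := by
    rw [norm_sub_rev]
    exact norm_derivAdj_sub_le hL hb' hb _
  have h2 : (pert K b b' q).snd = (K b - K b' - fderiv ℝ K b' (b - b'))
      + (fderiv ℝ K b (q.fst - b) - fderiv ℝ K b' (q.fst - b)) := by
    simp only [pert, WithLp.toLp_snd, map_sub]
    abel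
  have h3 : ‖(pert K b b' q).snd‖ ≤ L * ‖b - b'‖ * ‖b - b'‖ + L * ‖b - b'‖ * ‖q.fst - b‖ := by
    rw [h2]
    exact (norm_add_le _ _).trans (add_le_add (norm_taylor_le hK hL hb' hb)
      (norm_fderiv_sub_apply_le hL hb hb' _))
  linarith

theorem norm_pert_sub_le (hL : LipschitzOnWith L (fderiv ℝ K) (closedBall 0 R)) {b b' : X}
    (hb : ‖b‖ ≤ R) (hb' : ‖b'‖ ≤ R) (q q' : WithLp 2 (X × Y)) :
    ‖pert K b b' q - pert K b b' q'‖ ≤ 2 * (L * ‖b - b'‖) * ‖q - q'‖ := by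
  refine (norm_le_fst_add_snd _).trans ?_
  have h1 : (pert K b b' q - pert K b b' q').fst
      = -(derivAdj K b (q.snd - q'.snd) - derivAdj K b' (q.snd - q'.snd)) := by
    simp only [pert, WithLp.sub_fst, WithLp.toLp_fst, map_sub]
    abel
  have h2 : (pert K b b' q - pert K b b' q').snd
      = fderiv ℝ K b (q.fst - q'.fst) - fderiv ℝ K b' (q.fst - q'.fst) := by
    simp only [pert, WithLp.sub_snd, WithLp.toLp_snd, map_sub]
    abel
  rw [h1, h2, norm_neg]
  have h3 := norm_derivAdj_sub_le hL hb hb' (q.snd - q'.snd)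
  have h4 := norm_fderiv_sub_apply_le hL hb hb' (q.fst - q'.fst)
  have h5 : 0 ≤ L * ‖b - b'‖ := by positivity
  have h6 := mul_le_mul_of_nonneg_left (norm_snd_sub_le q q') h5
  have h7 := mul_le_mul_of_nonneg_left (norm_fst_sub_le q q') h5
  linarith

end Lipschitz

/-- The coupling by `K'(b)` and its adjoint is skew, so its contributions cancel and only the
subdifferentials remain. -/
theorem opH_monotone (hG : IsProperConvexLsc G) (hF : IsProperConvexLsc F) {b : X}
    {p p' w w' : WithLp 2 (X × Y)} (h : w ∈ opH G F K b p) (h' : w' ∈ opH G F K b p') :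
    0 ≤ inner ℝ (w - w') (p - p') := by
  obtain ⟨⟨x, hx, hw₁⟩, y, hy, hw₂⟩ := h
  obtain ⟨⟨x', hx', hw₁'⟩, y', hy', hw₂'⟩ := h'
  have h1 := hG.subdiff_monotone hx hx'
  have h2 := hF.fenchelConj.subdiff_monotone hy hy'
  have e1 : (w - w').fst = (x - x') + derivAdj K b (p.snd - p'.snd) := by
    rw [WithLp.sub_fst, hw₁, hw₁', map_sub]; abel
  have e2 : (w - w').snd = (y - y') - fderiv ℝ K b (p.fst - p'.fst) := by
    rw [WithLp.sub_snd, hw₂, hw₂', map_sub]; abel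
  have e3 : inner ℝ (derivAdj K b (p.snd - p'.snd)) (p.fst - p'.fst)
      = inner ℝ (fderiv ℝ K b (p.fst - p'.fst)) (p.snd - p'.snd) := by
    rw [derivAdj, ContinuousLinearMap.adjoint_inner_left, real_inner_comm]
  rw [inner_eq_fst_add_snd, e1, e2, WithLp.sub_fst, WithLp.sub_snd, inner_add_left,
    inner_sub_left (y - y'), e3]
  linarith

theorem isClosed_graph_opH (hG : IsProperConvexLsc G) (hF : IsProperConvexLsc F) (b : X) :
    IsClosed {p : WithLp 2 (X × Y) × WithLp 2 (X × Y) | p.2 ∈ opH G F K b p.1} := by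
  apply IsSeqClosed.isClosed
  rintro p ⟨q, w⟩ hp hlim
  have hq : Tendsto (fun n => (p n).1) atTop (𝓝 q) := (continuous_fst.tendsto _).comp hlim
  have hw : Tendsto (fun n => (p n).2) atTop (𝓝 w) := (continuous_snd.tendsto _).comp hlim
  have fst_lim : ∀ {s : ℕ → WithLp 2 (X × Y)} {x}, Tendsto s atTop (𝓝 x) →
      Tendsto (fun n => (s n).fst) atTop (𝓝 x.fst) := fun {s x} h =>
    ((by fun_prop : Continuous fun q : WithLp 2 (X × Y) => q.fst).tendsto x).comp h
  have snd_lim : ∀ {s : ℕ → WithLp 2 (X × Y)} {x}, Tendsto s atTop (𝓝 x) →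
      Tendsto (fun n => (s n).snd) atTop (𝓝 x.snd) := fun {s x} h =>
    ((by fun_prop : Continuous fun q : WithLp 2 (X × Y) => q.snd).tendsto x).comp h
  constructor
  · refine ⟨w.fst - derivAdj K b q.snd, ?_, by abel⟩
    refine hG.mem_subdiff_of_tendsto (fst_lim hq) (z := fun n => (p n).2.fst -
      derivAdj K b (p n).1.snd) ?_ fun n => ?_
    · exact (fst_lim hw).sub (((derivAdj K b).continuous.tendsto _).comp (snd_lim hq))
    · obtain ⟨⟨z, hz, h⟩, -⟩ := hp n
      rw [h, add_sub_cancel_right]; exact hz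
  · refine ⟨w.snd + fderiv ℝ K b q.fst + (K b - fderiv ℝ K b b), ?_, by abel⟩
    refine hF.fenchelConj.mem_subdiff_of_tendsto (snd_lim hq) (z := fun n => (p n).2.snd +
      fderiv ℝ K b (p n).1.fst + (K b - fderiv ℝ K b b)) ?_ fun n => ?_
    · exact ((snd_lim hw).add (((fderiv ℝ K b).continuous.tendsto _).comp (fst_lim hq))).add_const _
    · obtain ⟨-, z, hz, h⟩ := hp n
      have : (p n).2.snd + fderiv ℝ K b (p n).1.fst + (K b - fderiv ℝ K b b) = z := by
        rw [h]; abel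
      rw [this]; exact hz

theorem zero_mem_opH_self_iff {q : WithLp 2 (X × Y)} :
    0 ∈ opH G F K q.fst q ↔ IsCriticalPoint G F K q := by
  simp only [opH, Set.mem_ofPred_eq, IsCriticalPoint, WithLp.zero_fst, WithLp.zero_snd]
  constructor
  · rintro ⟨⟨z, hz, h⟩, y, hy, h'⟩
    have e : K q.fst = y := by
      have : y - K q.fst = 0 := by rw [h']; abel
      exact (sub_eq_zero.1 this).symm
    have e' : -(derivAdj K q.fst q.snd) = z := neg_eq_of_add_eq_zero_left h.symm
    rw [e, e']
    exact ⟨hy, hz⟩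
  · rintro ⟨h, h'⟩
    exact ⟨⟨_, h', by simp⟩, _, h, by abel⟩

theorem exists_radius_metricRegularity (hG : IsProperConvexLsc G) (hF : IsProperConvexLsc F)
    (hK : Differentiable ℝ K) {L : ℝ≥0} {R : ℝ}
    (hL : LipschitzOnWith L (fderiv ℝ K) (closedBall 0 R)) {q₀ : WithLp 2 (X × Y)} (hR : ‖q₀‖ < R)
    {ℓ₀ ℓ : ℝ} (hreg : IsRegularityConstant (opH G F K q₀.fst) 0 q₀ ℓ₀) (hℓ : ℓ₀ < ℓ) :
    ∀ᶠ r in 𝓝[>] (0 : ℝ), ∀ (b : X) (q w : WithLp 2 (X × Y)), ‖b - q₀.fst‖ ≤ r → ‖q - q₀‖ ≤ r →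
      ‖w‖ ≤ r → w ∈ opH G F K b q → ∃ q', 0 ∈ opH G F K b q' ∧ ‖q - q'‖ ≤ ℓ * ‖w‖ := by
  -- The gap from `ℓ₀` to `ℓ₁` pays for attaining the distance, the gap from `ℓ₁` to `ℓ` for the
  -- factor `1 / (1 - ℓ₁ * ε)` of the perturbation lemma.
  obtain ⟨ℓ₁, h01, h1ℓ⟩ := exists_between hℓ
  have hℓ₁ : 0 < ℓ₁ := hreg.1.trans h01
  have hℓ0 : 0 < ℓ := hℓ₁.trans h1ℓ
  obtain ⟨r₁, hr₁, hS⟩ := hreg.exists_radius h01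
  have c1 : ∀ᶠ r in 𝓝[>] (0 : ℝ), ‖q₀‖ + r < R :=
    eventually_nhdsGT_lt_of_continuousAt (by fun_prop) (by simpa using hR)
  have c2 : ∀ᶠ r in 𝓝[>] (0 : ℝ), ℓ₁ + ℓ * (ℓ₁ * (2 * (L * r))) < ℓ :=
    eventually_nhdsGT_lt_of_continuousAt (by fun_prop) (by simpa using h1ℓ)
  have c3 : ∀ᶠ r in 𝓝[>] (0 : ℝ), L * r * (‖q₀‖ + r₁ + r + r₁) < r₁ :=
    eventually_nhdsGT_lt_of_continuousAt (by fun_prop) (by simpa using hr₁)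
  have c4 : ∀ᶠ r in 𝓝[>] (0 : ℝ), r + ℓ * r < r₁ :=
    eventually_nhdsGT_lt_of_continuousAt (by fun_prop) (by simpa using hr₁)
  filter_upwards [c1, c2, c3, c4, self_mem_nhdsWithin] with r h1 h2 h3 h4 hr0 b q w hb hq hw hwH
  have hr0' : 0 < r := hr0
  set ε := 2 * ((L : ℝ) * r) with hε
  have hε0 : 0 ≤ ε := by positivity
  have hb₀ : ‖q₀.fst‖ ≤ R := (norm_fst_le q₀).trans hR.le
  have hbR : ‖b‖ ≤ R := by
    have := norm_le_norm_add_norm_sub' b q₀.fst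
    have := norm_fst_le q₀
    linarith
  have hbb : L * ‖q₀.fst - b‖ ≤ L * r := by
    rw [norm_sub_rev]; gcongr
  have hlt : ℓ₁ * ε < 1 := by
    have : ℓ * (ℓ₁ * ε) < ℓ * 1 := by linarith
    exact lt_of_mul_lt_mul_left this hℓ0.le
  have hquot : ∀ t : ℝ, 0 ≤ t → ℓ₁ * t / (1 - ℓ₁ * ε) ≤ ℓ * t := fun t ht => by
    rw [div_le_iff₀ (by linarith)]
    have : ℓ₁ * t ≤ (ℓ - ℓ * (ℓ₁ * ε)) * t := by gcongr; linarith
    linarith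
  obtain ⟨q', hq', hqq'⟩ := exists_zero_of_lipschitz_perturbation (isClosed_graph_opH hG hF q₀.fst)
    hℓ₁ hε0 hS (g := pert K q₀.fst b)
    (fun p p' => (norm_pert_sub_le hL hb₀ hbR p p').trans (by rw [hε]; gcongr)) hlt
    (fun p hp => by
      refine (norm_pert_le hK hL hb₀ hbR p).trans (le_trans ?_ h3.le)
      have e1 : ‖p.snd‖ ≤ ‖q₀‖ + r₁ :=
        (norm_snd_le p).trans ((norm_le_norm_add_norm_sub' p q₀).trans (by gcongr))
      have e2 : ‖p.fst - q₀.fst‖ ≤ r₁ := (norm_fst_sub_le p q₀).trans hp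
      rw [norm_sub_rev] at hb
      gcongr)
    (q := q) (w := w)
    (by
      have := hquot ‖w‖ (norm_nonneg _)
      have : ℓ * ‖w‖ ≤ ℓ * r := by gcongr
      linarith)
    (by rw [← add_pert_mem_opH_iff (b' := b), sub_add_cancel]; exact hwH)
  refine ⟨q', ?_, hqq'.trans (hquot _ (norm_nonneg _))⟩
  rw [← add_pert_mem_opH_iff (b' := b), neg_add_cancel] at hq'
  exact hq'

theorem exists_radius_opH_lipschitz (hK : Differentiable ℝ K) {L : ℝ≥0} {R : ℝ}
    (hL : LipschitzOnWith L (fderiv ℝ K) (closedBall 0 R)) {q₀ : WithLp 2 (X × Y)} (hR : ‖q₀‖ < R)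
    {Λ : ℝ} (hΛ : L * ‖q₀.snd‖ < Λ) :
    ∀ᶠ r in 𝓝[>] (0 : ℝ), ∀ (b b' : X) (q : WithLp 2 (X × Y)), ‖b - q₀.fst‖ ≤ r →
      ‖b' - q₀.fst‖ ≤ r → ‖q - q₀‖ ≤ r → 0 ∈ opH G F K b q →
      ∃ w ∈ opH G F K b' q, ‖w‖ ≤ Λ * ‖b - b'‖ := by
  have c1 : ∀ᶠ r in 𝓝[>] (0 : ℝ), ‖q₀‖ + r < R :=
    eventually_nhdsGT_lt_of_continuousAt (by fun_prop) (by simpa using hR)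
  have c2 : ∀ᶠ r in 𝓝[>] (0 : ℝ), L * ((‖q₀.snd‖ + r) + 2 * r + 2 * r) < Λ :=
    eventually_nhdsGT_lt_of_continuousAt (by fun_prop) (by simpa using hΛ)
  filter_upwards [c1, c2] with r h1 h2 b b' q hb hb' hq h0
  have hball : ∀ x : X, ‖x - q₀.fst‖ ≤ r → ‖x‖ ≤ R := fun x hx => by
    have := norm_le_norm_add_norm_sub' x q₀.fst
    have := norm_fst_le q₀
    linarith
  have tri : ∀ x y : X, ‖x - q₀.fst‖ ≤ r → ‖y - q₀.fst‖ ≤ r → ‖x - y‖ ≤ 2 * r :=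
    fun x y hx hy => by
      have := norm_sub_le_norm_sub_add_norm_sub x q₀.fst y
      rw [norm_sub_rev q₀.fst y] at this
      linarith
  refine ⟨pert K b b' q, ?_, ?_⟩
  · have := (add_pert_mem_opH_iff (b' := b')).2 h0
    rwa [zero_add] at this
  · refine (norm_pert_le hK hL (hball b hb) (hball b' hb') q).trans ?_
    have e1 : ‖q.snd‖ ≤ ‖q₀.snd‖ + r :=
      (norm_le_norm_add_norm_sub' _ q₀.snd).trans
        (by have := (norm_snd_sub_le q q₀).trans hq; linarith)
    have e2 := tri b b' hb hb'
    have e3 := tri q.fst b ((norm_fst_sub_le q q₀).trans hq) hb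
    calc L * ‖b - b'‖ * (‖q.snd‖ + ‖b - b'‖ + ‖q.fst - b‖)
        ≤ L * ‖b - b'‖ * ((‖q₀.snd‖ + r) + 2 * r + 2 * r) := by gcongr
      _ = L * ((‖q₀.snd‖ + r) + 2 * r + 2 * r) * ‖b - b'‖ := by ring
      _ ≤ Λ * ‖b - b'‖ := by gcongr

/-! ### The preconditioner and a single step of the method -/

/-- The preconditioner as a linear map. -/
noncomputable def opMLin (K : X → Y) (σ τ : ℝ) (b : X) :
    WithLp 2 (X × Y) →ₗ[ℝ] WithLp 2 (X × Y) where
  toFun := opM K σ τ b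
  map_add' p q := by
    apply ext_fst_snd
    · simp only [opM, WithLp.add_fst, WithLp.add_snd, WithLp.toLp_fst, map_add, smul_add]; abel
    · simp only [opM, WithLp.add_fst, WithLp.add_snd, WithLp.toLp_snd, map_add, smul_add]; abel
  map_smul' c q := by
    apply ext_fst_snd
    · simp only [opM, WithLp.smul_fst, WithLp.smul_snd, WithLp.toLp_fst, map_smul, smul_sub,
        RingHom.id_apply, smul_comm c]
    · simp only [opM, WithLp.smul_fst, WithLp.smul_snd, WithLp.toLp_snd, map_smul, smul_add,
        RingHom.id_apply, smul_comm c, smul_neg]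

theorem opMLin_isSymmetric (σ τ : ℝ) (b : X) : (opMLin K σ τ b).IsSymmetric := by
  intro p q
  change inner ℝ (opM K σ τ b p) q = inner ℝ p (opM K σ τ b q)
  simp only [inner_eq_fst_add_snd, opM, WithLp.toLp_fst, WithLp.toLp_snd, inner_sub_left,
    inner_sub_right, inner_add_left, inner_add_right, inner_neg_left, inner_neg_right,
    inner_smul_left, inner_smul_right, conj_trivial, derivAdj,
    ContinuousLinearMap.adjoint_inner_left, ContinuousLinearMap.adjoint_inner_right]
  ring

/-- One step of the primal-dual extragradient method. -/
structure IsStep (G : X → EReal) (F : Y → EReal) (K : X → Y) (τ σ ω : ℝ)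
    (q q' : WithLp 2 (X × Y)) : Prop where
  primal : IsProx G τ (q.fst - τ • derivAdj K q.fst q.snd) q'.fst
  dual : IsProx (fenchelConj F) σ (q.snd + σ • K (q'.fst + ω • (q'.fst - q.fst))) q'.snd

namespace IsStep

theorem exists_next (hG : IsProperConvexLsc G) (hF : IsProperConvexLsc F) {τ σ : ℝ} (hτ : 0 < τ)
    (hσ : 0 < σ) (ω : ℝ) (q : WithLp 2 (X × Y)) : ∃ q', IsStep G F K τ σ ω q q' := by
  obtain ⟨u, hu⟩ := hG.exists_isProx hτ (q.fst - τ • derivAdj K q.fst q.snd)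
  obtain ⟨v, hv⟩ := hF.fenchelConj.exists_isProx hσ (q.snd + σ • K (u + ω • (u - q.fst)))
  exact ⟨WithLp.toLp 2 (u, v), hu, hv⟩

variable {τ σ ω : ℝ} {q q' : WithLp 2 (X × Y)}

theorem primal_mem (hG : IsProperConvexLsc G) (hτ : 0 < τ) (h : IsStep G F K τ σ ω q q') :
    -(τ⁻¹ • (q'.fst - q.fst)) - derivAdj K q.fst q.snd ∈ subdiff G q'.fst := by
  have := (hG.isProx_iff_mem_subdiff hτ).1 h.primal
  convert this using 1
  simp only [smul_sub, smul_smul, inv_mul_cancel₀ hτ.ne', one_smul]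
  abel

theorem dual_mem (hF : IsProperConvexLsc F) (hσ : 0 < σ) (h : IsStep G F K τ σ ω q q') :
    K (q'.fst + ω • (q'.fst - q.fst)) - σ⁻¹ • (q'.snd - q.snd) ∈
      subdiff (fenchelConj F) q'.snd := by
  have := (hF.fenchelConj.isProx_iff_mem_subdiff hσ).1 h.dual
  convert this using 1
  generalize K (q'.fst + ω • (q'.fst - q.fst)) = k
  simp only [smul_sub, smul_add, smul_smul, inv_mul_cancel₀ hσ.ne', one_smul]
  abel

/-- At a fixed point the extrapolation vanishes, so `ω` is arbitrary; this makes the acceleration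
phase harmless. -/
theorem of_isCriticalPoint (hG : IsProperConvexLsc G) (hF : IsProperConvexLsc F) (hτ : 0 < τ)
    (hσ : 0 < σ) (ω : ℝ) (h : IsCriticalPoint G F K q) : IsStep G F K τ σ ω q q := by
  refine ⟨(hG.isProx_iff_mem_subdiff hτ).2 ?_, (hF.fenchelConj.isProx_iff_mem_subdiff hσ).2 ?_⟩
  · convert h.2 using 1
    rw [sub_sub_cancel_left, smul_neg, smul_smul, inv_mul_cancel₀ hτ.ne', one_smul]
  · convert h.1 using 1
    rw [add_sub_cancel_left, smul_smul, inv_mul_cancel₀ hσ.ne', one_smul, sub_self, smul_zero,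
      add_zero]

end IsStep

theorem continuous_derivAdj_apply (hK' : Continuous (fderiv ℝ K)) :
    Continuous fun q : WithLp 2 (X × Y) => derivAdj K q.fst q.snd := by
  have h : Continuous fun u => derivAdj K u :=
    (ContinuousLinearMap.adjoint (𝕜 := ℝ) (E := X) (F := Y)).continuous.comp hK'
  exact (h.comp (by fun_prop : Continuous fun q : WithLp 2 (X × Y) => q.fst)).clm_apply
    (by fun_prop)

/-- The step map is continuous at a critical point, which is one of its fixed points. -/
theorem exists_radius_isStep (hG : IsProperConvexLsc G) (hF : IsProperConvexLsc F)
    (hK : Continuous K) (hK' : Continuous (fderiv ℝ K)) {τ σ : ℝ} (hτ : 0 < τ) (hσ : 0 < σ) (ω : ℝ)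
    {q₀ : WithLp 2 (X × Y)} (h₀ : IsCriticalPoint G F K q₀) {ρ : ℝ} (hρ : 0 < ρ) :
    ∃ δ > 0, ∀ q q', ‖q - q₀‖ ≤ δ → IsStep G F K τ σ ω q q' → ‖q' - q₀‖ ≤ ρ := by
  have hfix := IsStep.of_isCriticalPoint hG hF hτ hσ ω h₀
  set φ : WithLp 2 (X × Y) → X := fun q => q.fst - τ • derivAdj K q.fst q.snd with hφ
  set ψ : WithLp 2 (X × Y) × X → Y :=
    fun p => p.1.snd + σ • K (p.2 + ω • (p.2 - p.1.fst)) with hψ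
  have hφc : Continuous φ := by
    have := continuous_derivAdj_apply hK'
    fun_prop
  have hψc : Continuous ψ := by
    fun_prop
  obtain ⟨δ₁, hδ₁, h₁⟩ := Metric.continuousAt_iff.1 (hψc.continuousAt (x := (q₀, q₀.fst)))
    (ρ / 2) (by positivity)
  -- The dual update uses the new primal iterate, so the primal error must also fit into the dual
  -- radius `δ₁`.
  obtain ⟨δ₂, hδ₂, h₂⟩ := Metric.continuousAt_iff.1 (hφc.continuousAt (x := q₀))
    (min (ρ / 2) (δ₁ / 2)) (by positivity)
  refine ⟨min (δ₁ / 2) (δ₂ / 2), by positivity, fun q q' hq hstep => ?_⟩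
  have hq1 : ‖q - q₀‖ < δ₁ := by linarith [hq.trans (min_le_left _ _)]
  have hq2 : ‖q - q₀‖ < δ₂ := by linarith [hq.trans (min_le_right _ _)]
  have e1 : ‖q'.fst - q₀.fst‖ < min (ρ / 2) (δ₁ / 2) := by
    refine (hG.norm_sub_le_of_isProx hτ hstep.primal hfix.primal).trans_lt ?_
    have := h₂ (x := q) (by rwa [dist_eq_norm])
    rwa [dist_eq_norm] at this
  have e2 : ‖q'.snd - q₀.snd‖ < ρ / 2 := by
    refine (hF.fenchelConj.norm_sub_le_of_isProx hσ hstep.dual hfix.dual).trans_lt ?_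
    have := h₁ (x := (q, q'.fst)) (by
      rw [Prod.dist_eq, dist_eq_norm, dist_eq_norm]
      exact max_lt hq1 (by linarith [e1.trans_le (min_le_right _ _)]))
    rwa [dist_eq_norm] at this
  refine (norm_le_fst_add_snd _).trans ?_
  rw [WithLp.sub_fst, WithLp.sub_snd]
  linarith [e1.trans_le (min_le_left _ _)]

/-- A step without acceleration is, up to a small error, a proximal point step for the operator
`opH` with base point the current iterate, preconditioned with a fixed base point. -/
theorem exists_radius_isStep_inclusion (hG : IsProperConvexLsc G) (hF : IsProperConvexLsc F)
    (hK : Differentiable ℝ K) {L : ℝ≥0} {R : ℝ}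
    (hL : LipschitzOnWith L (fderiv ℝ K) (closedBall 0 R)) {q₀ : WithLp 2 (X × Y)} (hR : ‖q₀‖ < R)
    {τ σ : ℝ} (hτ : 0 < τ) (hσ : 0 < σ) {ε : ℝ} (hε : 0 < ε) :
    ∀ᶠ r in 𝓝[>] (0 : ℝ), ∀ q q', ‖q - q₀‖ ≤ r → ‖q' - q₀‖ ≤ r → IsStep G F K τ σ 1 q q' →
      ∃ e, ‖e‖ ≤ ε * ‖q' - q‖ ∧
        -(opMLin K σ τ q₀.fst (q' - q) + e) ∈ opH G F K q.fst q' := by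
  have c1 : ∀ᶠ r in 𝓝[>] (0 : ℝ), ‖q₀‖ + 3 * r < R :=
    eventually_nhdsGT_lt_of_continuousAt (by fun_prop) (by simpa using hR)
  have c2 : ∀ᶠ r in 𝓝[>] (0 : ℝ), 10 * (L * r) < ε :=
    eventually_nhdsGT_lt_of_continuousAt (by fun_prop) (by simpa using hε)
  filter_upwards [c1, c2, self_mem_nhdsWithin] with r h1 h2 hr0 q q' hq hq' hstep
  have hr0' : 0 < r := hr0
  set u := q.fst with hu
  set u' := q'.fst with hu'
  set v := q.snd with hv
  set v' := q'.snd with hv'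
  set û := q₀.fst with hû
  set ub := u' + (1 : ℝ) • (u' - u) with hub
  have eu : ‖u - û‖ ≤ r := (norm_fst_sub_le q q₀).trans hq
  have eu' : ‖u' - û‖ ≤ r := (norm_fst_sub_le q' q₀).trans hq'
  have euu : ‖u' - u‖ ≤ 2 * r := by
    have := norm_sub_le_norm_sub_add_norm_sub u' û u
    rw [norm_sub_rev û u] at this
    linarith
  have hball : ∀ x : X, ‖x - û‖ ≤ 3 * r → ‖x‖ ≤ R := fun x hx => by
    have := norm_le_norm_add_norm_sub' x û
    have := norm_fst_le q₀
    linarith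
  -- Here `ω = 1` matters: linearizing `K ub` at `u` gives `2 K'(u) (u' - u)`. One copy moves the
  -- linearization to `u'`, the other is the off-diagonal entry that makes the preconditioner
  -- symmetric.
  have hubu : ub - u = (2 : ℝ) • (u' - u) := by rw [hub]; module
  have hubR : ‖ub‖ ≤ R := by
    refine hball _ ?_
    have : ub - û = (u' - û) + (u' - u) := by rw [hub]; module
    rw [this]
    linarith [norm_add_le (u' - û) (u' - u)]
  have huR : ‖u‖ ≤ R := hball _ (by linarith)
  have hûR : ‖û‖ ≤ R := (norm_fst_le q₀).trans hR.le
  set D := K ub - K u - fderiv ℝ K u (ub - u) with hD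
  set e₁ := -(derivAdj K u (v' - v) - derivAdj K û (v' - v)) with he₁
  set e₂ := -(D + (fderiv ℝ K u (u' - u) - fderiv ℝ K û (u' - u))) with he₂
  refine ⟨WithLp.toLp 2 (e₁, e₂), ?_, ?_⟩
  · refine (norm_le_fst_add_snd _).trans ?_
    rw [WithLp.toLp_fst, WithLp.toLp_snd, he₁, he₂, norm_neg, norm_neg]
    have hd1 : ‖u' - u‖ ≤ ‖q' - q‖ := norm_fst_sub_le q' q
    have hd2 : ‖v' - v‖ ≤ ‖q' - q‖ := norm_snd_sub_le q' q
    have f1 : ‖derivAdj K u (v' - v) - derivAdj K û (v' - v)‖ ≤ L * r * ‖q' - q‖ :=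
      (norm_derivAdj_sub_le hL huR hûR _).trans (by gcongr)
    have f2 : ‖fderiv ℝ K u (u' - u) - fderiv ℝ K û (u' - u)‖ ≤ L * r * ‖q' - q‖ :=
      (norm_fderiv_sub_apply_le hL huR hûR _).trans (by gcongr)
    have f3 : ‖D‖ ≤ 8 * (L * r) * ‖q' - q‖ := by
      refine (norm_taylor_le hK hL huR hubR).trans ?_
      rw [hubu, norm_smul, Real.norm_ofNat]
      calc (L : ℝ) * (2 * ‖u' - u‖) * (2 * ‖u' - u‖)
          ≤ L * (2 * (2 * r)) * (2 * ‖q' - q‖) := by gcongr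
        _ = _ := by ring
    have f4 := norm_add_le D (fderiv ℝ K u (u' - u) - fderiv ℝ K û (u' - u))
    have f5 : 10 * (L * r) * ‖q' - q‖ ≤ ε * ‖q' - q‖ := by gcongr
    linarith
  · have hp := hstep.primal_mem hG hτ
    have hd := hstep.dual_mem hF hσ
    refine ⟨⟨_, hp, ?_⟩, _, hd, ?_⟩
    · change -((τ⁻¹ • (q' - q).fst - derivAdj K û (q' - q).snd) + e₁) = _
      rw [WithLp.sub_fst, WithLp.sub_snd, he₁]
      simp only [map_sub]
      abel
    · change -((-(fderiv ℝ K û (u' - u)) + σ⁻¹ • (v' - v)) + e₂) =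
        K ub - σ⁻¹ • (v' - v) - fderiv ℝ K u u' - (K u - fderiv ℝ K u u)
      rw [he₂, hD, hubu]
      simp only [map_sub, map_add, two_smul]
      abel

/-- Increments vanish in the limit of the step inclusions, and subdifferentials have closed graphs.
-/
theorem isCriticalPoint_of_tendsto (hG : IsProperConvexLsc G) (hF : IsProperConvexLsc F)
    (hK : Continuous K) (hK' : Continuous (fderiv ℝ K)) {τ σ ω : ℝ} (hτ : 0 < τ) (hσ : 0 < σ)
    {q : ℕ → WithLp 2 (X × Y)} (hq : ∀ i, IsStep G F K τ σ ω (q i) (q (i + 1)))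
    {qs : WithLp 2 (X × Y)} (hlim : Tendsto q atTop (𝓝 qs)) : IsCriticalPoint G F K qs := by
  have hlim' : Tendsto (fun i => (q i, q (i + 1))) atTop (𝓝 (qs, qs)) :=
    hlim.prodMk_nhds (hlim.comp (tendsto_add_atTop_nat 1))
  have hadj := (continuous_derivAdj_apply hK').comp
    (continuous_fst (X := WithLp 2 (X × Y)) (Y := WithLp 2 (X × Y)))
  simp only [Function.comp_def] at hadj
  have h₁ : Continuous fun p : WithLp 2 (X × Y) × WithLp 2 (X × Y) =>
      K (p.2.fst + ω • (p.2.fst - p.1.fst)) - σ⁻¹ • (p.2.snd - p.1.snd) := by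
    fun_prop
  have h₂ : Continuous fun p : WithLp 2 (X × Y) × WithLp 2 (X × Y) =>
      -(τ⁻¹ • (p.2.fst - p.1.fst)) - derivAdj K p.1.fst p.1.snd := by
    fun_prop
  have h₃ : Continuous fun p : WithLp 2 (X × Y) × WithLp 2 (X × Y) => p.2.snd := by fun_prop
  have h₄ : Continuous fun p : WithLp 2 (X × Y) × WithLp 2 (X × Y) => p.2.fst := by fun_prop
  constructor
  · have := hF.fenchelConj.mem_subdiff_of_tendsto ((h₃.tendsto _).comp hlim')
      ((h₁.tendsto _).comp hlim') fun i => (hq i).dual_mem hF hσ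
    simpa using this
  · have := hG.mem_subdiff_of_tendsto ((h₄.tendsto _).comp hlim')
      ((h₂.tendsto _).comp hlim') fun i => (hq i).primal_mem hG hτ
    simpa using this

/-! ### The smallness condition and the contraction factor -/

/-- The second form is continuous at `m = 0` with value `0`, matching the reading of the condition
for zero regularity modulus and permitting a continuity argument in `ℓ`. -/
theorem one_div_sqrt_one_add_inv {m : ℝ} (hm : 0 < m) :
    1 / √(1 + 1 / (2 * m ^ 2)) = √(2 * m ^ 2 / (2 * m ^ 2 + 1)) := by
  rw [one_div, ← Real.sqrt_inv]
  congr 1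
  field_simp

/-- The smallness condition in `[0, ∞]` as an inequality of real numbers. -/
theorem smallness_toReal {lip a : ℝ≥0} {κ Θ : ℝ} (hκ : 0 ≤ κ) (hΘ : 0 < Θ)
    (h : (lip : ℝ≥0∞) * ENNReal.ofReal κ * a <
      1 - 1 / (1 + 1 / (2 * (lip : ℝ≥0∞) ^ 2 * ENNReal.ofReal Θ ^ 4)) ^ (1 / 2 : ℝ)) :
    κ * lip * a + √(2 * (lip * Θ ^ 2) ^ 2 / (2 * (lip * Θ ^ 2) ^ 2 + 1)) < 1 := by
  rcases eq_or_ne lip 0 with rfl | hlip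
  · simp
  have hl : (0 : ℝ) < lip := by positivity
  have hm : 0 < lip * Θ ^ 2 := by positivity
  rw [← one_div_sqrt_one_add_inv hm]
  have e1 : (2 * (lip : ℝ≥0∞) ^ 2 * ENNReal.ofReal Θ ^ 4)
      = ENNReal.ofReal (2 * (lip * Θ ^ 2) ^ 2) := by
    rw [show 2 * (lip * Θ ^ 2) ^ 2 = 2 * (lip : ℝ) ^ 2 * Θ ^ 4 by ring,
      ENNReal.ofReal_mul (by positivity), ENNReal.ofReal_mul (by positivity),
      ENNReal.ofReal_pow hl.le, ENNReal.ofReal_pow hΘ.le, ENNReal.ofReal_coe_nnreal]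
    simp
  have hpos : (0 : ℝ) < 2 * (lip * Θ ^ 2) ^ 2 := by positivity
  have hpos' : (0 : ℝ) < 1 + 1 / (2 * (lip * Θ ^ 2) ^ 2) := by positivity
  have e2 : (1 / (1 + 1 / (2 * (lip : ℝ≥0∞) ^ 2 * ENNReal.ofReal Θ ^ 4)) ^ (1 / 2 : ℝ))
      = ENNReal.ofReal (1 / √(1 + 1 / (2 * (lip * Θ ^ 2) ^ 2))) := by
    rw [e1, Real.sqrt_eq_rpow, ENNReal.ofReal_div_of_pos (by positivity), ENNReal.ofReal_one,
      ← ENNReal.ofReal_rpow_of_pos hpos', ENNReal.ofReal_add one_pos.le (by positivity),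
      ENNReal.ofReal_div_of_pos hpos, ENNReal.ofReal_one]
  have e3 : (lip : ℝ≥0∞) * ENNReal.ofReal κ * a = ENNReal.ofReal (κ * lip * a) := by
    rw [ENNReal.ofReal_mul (by positivity), ENNReal.ofReal_mul hκ, ENNReal.ofReal_coe_nnreal,
      ENNReal.ofReal_coe_nnreal, mul_comm (lip : ℝ≥0∞)]
  rw [e2, e3, ← ENNReal.ofReal_one, ← ENNReal.ofReal_sub _ (by positivity)] at h
  have := (ENNReal.ofReal_lt_ofReal_iff'.1 h).1
  linarith

theorem exists_isRegularityConstant_lt {Q W : Type*} [PseudoEMetricSpace Q] [PseudoEMetricSpace W]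
    {S : Q → Set W} {w₀ : W} {q₀ : Q} {lip : ℝ≥0} (hlip : lip = lipInv S w₀ q₀) {f : ℝ → ℝ} {c : ℝ}
    (hf : Continuous f) (h : f lip < c) :
    ∃ ℓ₀ ℓ, IsRegularityConstant S w₀ q₀ ℓ₀ ∧ ℓ₀ < ℓ ∧ f ℓ < c := by
  obtain ⟨ℓ, hℓc, hℓ⟩ := ((((hf.tendsto _).eventually_lt_const h).filter_mono
    nhdsWithin_le_nhds).and (self_mem_nhdsWithin (s := Set.Ioi (lip : ℝ)))).exists
  have hlt : lipInv S w₀ q₀ < ENNReal.ofReal ℓ := by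
    rw [← hlip, ← ENNReal.ofReal_coe_nnreal]
    exact (ENNReal.ofReal_lt_ofReal_iff (lt_of_le_of_lt lip.2 hℓ)).2 hℓ
  simp only [lipInv, iInf_lt_iff] at hlt
  obtain ⟨ℓ₀, h₀, hlt⟩ := hlt
  exact ⟨ℓ₀, ℓ, h₀, (ENNReal.ofReal_lt_ofReal_iff'.1 hlt).1, hℓc⟩

theorem eventually_contraction_params {θ Θ ℓ a ρ : ℝ} (hΘ : 0 < Θ) (hℓ : 0 < ℓ)
    (hρ : ρ = √(2 * (ℓ * Θ ^ 2) ^ 2 / (2 * (ℓ * Θ ^ 2) ^ 2 + 1)))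
    (h : Θ / θ * ℓ * a + ρ < 1) :
    ∀ᶠ t in 𝓝[>] (0 : ℝ), 0 < 1 - t / θ ^ 2 ∧
      1 ≤ ρ ^ 2 * (1 + 1 / (Θ * ℓ * (Θ + t / θ)) ^ 2) * (1 - t / θ ^ 2) ∧
      ρ + Θ / θ * ℓ * (a + t) / √(1 - t / θ ^ 2) < 1 := by
  have c1 : ∀ᶠ t in 𝓝[>] (0 : ℝ), t / θ ^ 2 < 1 :=
    eventually_nhdsGT_lt_of_continuousAt (by fun_prop) (by simp)
  -- With `m = ℓ * Θ ^ 2`, the product at `t = 0` is `(2 m² + 2) / (2 m² + 1) > 1`: the 2 in `ρ`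
  -- leaves room for the error `t`.
  have c2 : ∀ᶠ t in 𝓝[>] (0 : ℝ),
      -(ρ ^ 2 * (1 + 1 / (Θ * ℓ * (Θ + t / θ)) ^ 2) * (1 - t / θ ^ 2)) < -1 := by
    refine eventually_nhdsGT_lt_of_continuousAt ?_ ?_
    · have : (Θ * ℓ * (Θ + 0 / θ)) ^ 2 ≠ 0 := by
        rw [zero_div, add_zero]; positivity
      fun_prop (disch := assumption)
    · rw [zero_div, zero_div, add_zero, sub_zero, mul_one, neg_lt_neg_iff, hρ,
        Real.sq_sqrt (by positivity), div_mul_eq_mul_div, lt_div_iff₀ (by positivity)]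
      have : 2 * (ℓ * Θ ^ 2) ^ 2 * (1 + 1 / (Θ * ℓ * Θ) ^ 2) = 2 * (ℓ * Θ ^ 2) ^ 2 + 2 := by
        field_simp
      rw [this]
      linarith
  have c3 : ∀ᶠ t in 𝓝[>] (0 : ℝ), ρ + Θ / θ * ℓ * (a + t) / √(1 - t / θ ^ 2) < 1 := by
    refine eventually_nhdsGT_lt_of_continuousAt ?_ ?_
    · have : √(1 - 0 / θ ^ 2) ≠ 0 := by simp
      fun_prop (disch := assumption)
    · simp only [zero_div, sub_zero, Real.sqrt_one, div_one, add_zero]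
      linarith
  filter_upwards [c1, c2, c3] with t h1 h2 h3
  exact ⟨by linarith, by linarith, h3⟩

/-! ### Step lengths, the accelerated phase and local convergence -/

section Steps

variable {μ σ₀ τ₀ : ℝ} {N : ℕ}

theorem stepσ_pos (hμ : 0 ≤ μ) (hσ₀ : 0 < σ₀) : ∀ i, 0 < stepσ μ σ₀ N i
  | 0 => hσ₀
  | i + 1 => by
    have h := stepσ_pos hμ hσ₀ i
    refine mul_pos ?_ h
    unfold accelFactor
    split_ifs
    · positivity
    · exact one_pos

theorem stepω_pos (hμ : 0 ≤ μ) (hσ₀ : 0 < σ₀) (i : ℕ) : 0 < stepω μ σ₀ N i := by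
  have h := stepσ_pos hμ hσ₀ (N := N) i
  unfold stepω accelFactor
  split_ifs
  · positivity
  · exact one_pos

theorem stepτ_pos (hμ : 0 ≤ μ) (hσ₀ : 0 < σ₀) (hτ₀ : 0 < τ₀) : ∀ i, 0 < stepτ μ σ₀ τ₀ N i
  | 0 => hτ₀
  | i + 1 => div_pos (stepτ_pos hμ hσ₀ hτ₀ i) (stepω_pos hμ hσ₀ i)

theorem stepω_eq_one {i : ℕ} (hi : N ≤ i) : stepω μ σ₀ N i = 1 := if_neg (not_lt.2 hi)

theorem stepσ_add (i : ℕ) : stepσ μ σ₀ N (i + N) = stepσ μ σ₀ N N := by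
  induction i with
  | zero => rw [zero_add]
  | succ i ih =>
    rw [Nat.succ_add, ← ih]
    change stepω μ σ₀ N (i + N) * _ = _
    rw [stepω_eq_one (by lia), one_mul]

theorem stepτ_add (i : ℕ) : stepτ μ σ₀ τ₀ N (i + N) = stepτ μ σ₀ τ₀ N N := by
  induction i with
  | zero => rw [zero_add]
  | succ i ih =>
    rw [Nat.succ_add, ← ih]
    change _ / stepω μ σ₀ N (i + N) = _
    rw [stepω_eq_one (by lia), div_one]

end Steps

variable {X Y : Type*} [NormedAddCommGroup X] [InnerProductSpace ℝ X] [CompleteSpace X]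
  [NormedAddCommGroup Y] [InnerProductSpace ℝ Y] [CompleteSpace Y]
  {G : X → EReal} {F : Y → EReal} {K : X → Y}

theorem IsIterates.isStep {τ σ ω : ℕ → ℝ} {q : ℕ → WithLp 2 (X × Y)}
    (h : IsIterates G F K τ σ ω q) (i : ℕ) : IsStep G F K (τ i) (σ i) (ω i) (q i) (q (i + 1)) :=
  ⟨h.primal i, h.dual i⟩

theorem exists_isIterates (hG : IsProperConvexLsc G) (hF : IsProperConvexLsc F) {τ σ : ℕ → ℝ}
    (hτ : ∀ i, 0 < τ i) (hσ : ∀ i, 0 < σ i) (ω : ℕ → ℝ) (q₀ : WithLp 2 (X × Y)) :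
    ∃ q : ℕ → WithLp 2 (X × Y), q 0 = q₀ ∧ IsIterates G F K τ σ ω q := by
  choose next hnext using fun i => IsStep.exists_next (K := K) hG hF (hτ i) (hσ i) (ω i)
  let q : ℕ → WithLp 2 (X × Y) := fun n => Nat.rec (motive := fun _ => WithLp 2 (X × Y)) q₀ next n
  have hq : ∀ i, IsStep G F K (τ i) (σ i) (ω i) (q i) (q (i + 1)) := fun i => hnext i (q i)
  exact ⟨q, rfl, fun i => (hq i).primal, fun i => (hq i).dual⟩

/-- Finitely many step maps, each continuous at the common fixed point `q₀`, are composed. -/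
theorem exists_radius_isIterates (hG : IsProperConvexLsc G) (hF : IsProperConvexLsc F)
    (hK : Continuous K) (hK' : Continuous (fderiv ℝ K)) {τ σ ω : ℕ → ℝ}
    (hτ : ∀ i, 0 < τ i) (hσ : ∀ i, 0 < σ i) {q₀ : WithLp 2 (X × Y)}
    (h₀ : IsCriticalPoint G F K q₀) (n : ℕ) :
    ∀ ρ > (0 : ℝ), ∃ δ > 0, ∀ q : ℕ → WithLp 2 (X × Y), IsIterates G F K τ σ ω q →
      ‖q 0 - q₀‖ ≤ δ → ‖q n - q₀‖ ≤ ρ := by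
  induction n with
  | zero => exact fun ρ hρ => ⟨ρ, hρ, fun q _ h => h⟩
  | succ n ih =>
    intro ρ hρ
    obtain ⟨ρ', hρ', h⟩ := exists_radius_isStep hG hF hK hK' (hτ n) (hσ n) (ω n) h₀ hρ
    obtain ⟨δ, hδ, h'⟩ := ih ρ' hρ'
    exact ⟨δ, hδ, fun q hq h0 => h _ _ (h' q hq h0) (hq.isStep n)⟩

/-- Local convergence of the method without acceleration. -/
theorem exists_radius_tendsto (hG : IsProperConvexLsc G) (hF : IsProperConvexLsc F)
    (hK : Differentiable ℝ K) (hK' : Continuous (fderiv ℝ K)) {L : ℝ≥0} {R : ℝ}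
    (hL : LipschitzOnWith L (fderiv ℝ K) (closedBall 0 R)) {q₀ : WithLp 2 (X × Y)} (hR : ‖q₀‖ < R)
    (h₀ : IsCriticalPoint G F K q₀) {τ σ : ℝ} (hτ : 0 < τ) (hσ : 0 < σ) {θ Θ : ℝ}
    (hM : IsPreconditioner (opMLin K σ τ q₀.fst) θ Θ) {ℓ₀ ℓ : ℝ}
    (hreg : IsRegularityConstant (opH G F K q₀.fst) 0 q₀ ℓ₀) (hℓ : ℓ₀ < ℓ)
    (hsmall : Θ / θ * ℓ * (L * ‖q₀.snd‖) +
      √(2 * (ℓ * Θ ^ 2) ^ 2 / (2 * (ℓ * Θ ^ 2) ^ 2 + 1)) < 1) :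
    ∃ δ > 0, ∀ q : ℕ → WithLp 2 (X × Y), ‖q 0 - q₀‖ ≤ δ →
      (∀ i, IsStep G F K τ σ 1 (q i) (q (i + 1))) →
      ∃ qs, Tendsto q atTop (𝓝 qs) ∧ IsCriticalPoint G F K qs := by
  have hθ := hM.pos
  have hΘ := hM.pos'
  have hℓ0 : 0 < ℓ := hreg.1.trans hℓ
  set ρ := √(2 * (ℓ * Θ ^ 2) ^ 2 / (2 * (ℓ * Θ ^ 2) ^ 2 + 1)) with hρ
  obtain ⟨ε, ⟨hs0, hρ1, hc1⟩, hε⟩ := ((eventually_contraction_params hΘ hℓ0 hρ hsmall).and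
    (self_mem_nhdsWithin (s := Set.Ioi (0 : ℝ)))).exists
  have hε0 : 0 < ε := hε
  set Λ := L * ‖q₀.snd‖ + ε with hΛ
  have hΛ0 : 0 ≤ Λ := by positivity
  obtain ⟨r, ⟨hMR, hLip⟩, hr⟩ := (((exists_radius_metricRegularity hG hF hK hL hR hreg hℓ).and
    (exists_radius_opH_lipschitz (G := G) (F := F) hK hL hR
      (lt_add_of_pos_right (L * ‖q₀.snd‖) hε0))).and
    (self_mem_nhdsWithin (s := Set.Ioi (0 : ℝ)))).exists
  have hr0 : 0 < r := hr
  have d1 : ∀ᶠ r' in 𝓝[>] (0 : ℝ), r' < r :=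
    eventually_nhdsGT_lt_of_continuousAt (by fun_prop) hr0
  have d2 : ∀ᶠ r' in 𝓝[>] (0 : ℝ), (Θ ^ 2 + ε) * (2 * r') < r :=
    eventually_nhdsGT_lt_of_continuousAt (by fun_prop) (by simpa using hr0)
  have d3 : ∀ᶠ r' in 𝓝[>] (0 : ℝ), r' + ℓ * ((Θ ^ 2 + ε) * (2 * r')) < r :=
    eventually_nhdsGT_lt_of_continuousAt (by fun_prop) (by simpa using hr0)
  have d4 : ∀ᶠ r' in 𝓝[>] (0 : ℝ), Λ * (2 * r') < r :=
    eventually_nhdsGT_lt_of_continuousAt (by fun_prop) (by simpa using hr0)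
  obtain ⟨r', ⟨e1, e2, e3, e4, hincl⟩, hr'⟩ := ((d1.and (d2.and (d3.and (d4.and
    (exists_radius_isStep_inclusion hG hF hK hL hR hτ hσ hε0))))).and
    (self_mem_nhdsWithin (s := Set.Ioi (0 : ℝ)))).exists
  have hr'0 : 0 < r' := hr'
  -- The step inclusion also needs the new iterate in the ball of radius `r'`; `r₂` guarantees this
  -- in advance.
  obtain ⟨r₂, hr₂, hcont⟩ := exists_radius_isStep hG hF hK.continuous hK' hτ hσ 1 h₀ hr'0
  have hr₁ : 0 < min r (r / (Λ + 1)) := by positivity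
  obtain ⟨δ, hδ, hconv⟩ := exists_radius_tendsto_of_contraction
    (n := opNorm (opMLin K σ τ q₀.fst)) (q₀ := q₀)
    (Z := fun q p => 0 ∈ opH G F K q.fst p) (Step := IsStep G F K τ σ 1)
    (lt_min hr'0 hr₂) hr₁ (Γ := Θ * (1 + ℓ * Λ)) (by positivity)
    (c := ρ + Θ / θ * ℓ * Λ / √(1 - ε / θ ^ 2)) (by positivity) hc1
    (C := 1 / (θ * √(1 - ε / θ ^ 2))) (by positivity) hθ hM.norm_le
    (by
      intro q hq
      have hqr : ‖q.fst - q₀.fst‖ ≤ r := (norm_fst_sub_le q q₀).trans (hq.trans (min_le_left _ _))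
      -- The first target comes from transporting the zero `q₀` to the base point of `q`, a shift of
      -- at most `ℓ * Λ * ‖q - q₀‖`.
      obtain ⟨w, hw, hwn⟩ := hLip q₀.fst q.fst q₀ (by simpa using hr0.le) hqr (by simpa using hr0.le)
        (zero_mem_opH_self_iff.2 h₀)
      have hwn' : ‖w‖ ≤ Λ * ‖q - q₀‖ := by
        refine hwn.trans ?_
        rw [norm_sub_rev]
        exact mul_le_mul_of_nonneg_left (norm_fst_sub_le q q₀) hΛ0
      obtain ⟨p, hp, hpn⟩ := hMR q.fst q₀ w hqr (by simpa using hr0.le) (by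
        have h1 : ‖q - q₀‖ * (Λ + 1) ≤ r := by
          rw [← le_div_iff₀ (by positivity)]; exact hq.trans (min_le_right _ _)
        linarith [norm_nonneg (q - q₀)]) hw
      refine ⟨p, hp, (hM.opNorm_le _).trans ?_⟩
      rw [mul_assoc]
      gcongr
      have h1 := norm_sub_le_norm_sub_add_norm_sub q q₀ p
      have h2 := mul_le_mul_of_nonneg_left hwn' hℓ0.le
      linarith)
    (by
      intro q p q' hq hp hp0 hstep
      have hq1 : ‖q - q₀‖ ≤ r' := hq.trans (min_le_left _ _)
      have hq' : ‖q' - q₀‖ ≤ r' := hcont q q' (hq.trans (min_le_right _ _)) hstep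
      obtain ⟨e, he, hmem⟩ := hincl q q' hq1 hq' hstep
      exact exists_zero_opNorm_le hM (T := fun b => opH G F K b.fst) hℓ0 hΛ0 hε0.le
        (fun b p p' w w' h h' => opH_monotone hG hF h h')
        (fun b q w hb => hMR b.fst q w ((norm_fst_sub_le b q₀).trans hb))
        (fun b b' q hb hb' hq h => by
          obtain ⟨w, hw, hwn⟩ := hLip b.fst b'.fst q ((norm_fst_sub_le b q₀).trans hb)
            ((norm_fst_sub_le b' q₀).trans hb') hq h
          exact ⟨w, hw, hwn.trans (mul_le_mul_of_nonneg_left (norm_fst_sub_le b b') hΛ0)⟩)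
        rfl rfl hs0 (Real.sqrt_nonneg _) hρ1 e1.le e2.le e3.le e4.le hq1 hq'
        (hp.trans (min_le_left _ _)) hp0 he hmem)
  refine ⟨δ, hδ, fun q hq hsteps => ?_⟩
  obtain ⟨qs, hqs, -⟩ := hconv q hq hsteps
  exact ⟨qs, hqs, isCriticalPoint_of_tendsto hG hF hK.continuous hK' hτ hσ hsteps hqs⟩

end NonlinearPD

theorem mainTheorem1
    {X Y : Type*} [NormedAddCommGroup X] [InnerProductSpace ℝ X] [CompleteSpace X]
    [NormedAddCommGroup Y] [InnerProductSpace ℝ Y] [CompleteSpace Y]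
    (G : X → EReal) (F : Y → EReal) (K : X → Y)
    (hG : NonlinearPD.IsProperConvexLsc G) (hGint : (interior (NonlinearPD.effDom G)).Nonempty)
    (hF : NonlinearPD.IsProperConvexLsc F) (hFint : (interior (NonlinearPD.effDom F)).Nonempty)
    (hK : Differentiable ℝ K) (hK' : LocallyLipschitz (fderiv ℝ K))
    -- strong convexity of `F^*`
    (γ : ℝ) (hγ : 0 < γ)
    (hFγ : NonlinearPD.IsStronglyConvex γ (NonlinearPD.fenchelConj F))
    -- the solution `qh` and the radius `R`
    (R : ℝ) (hR : 0 < R) (qh : WithLp 2 (X × Y))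
    (hsol : 0 ∈ NonlinearPD.opH G F K qh.fst qh) (hqR : ‖qh‖ ≤ R / 2)
    -- the Lipschitz factor of `K'` on the closed ball
    (L₂ : ℝ≥0) (hL₂ : LipschitzOnWith L₂ (fderiv ℝ K) (closedBall 0 R))
    -- step lengths, accelerated in the first `N` steps
    (μ : ℝ) (hμ : μ ∈ Set.Ico 0 γ) (N : ℕ)
    (σ₀ τ₀ : ℝ) (hσ₀ : 0 < σ₀) (hτ₀ : 0 < τ₀)
    (hστ : ENNReal.ofReal (σ₀ * τ₀) *
      (⨆ u ∈ closedBall (0 : X) R, ‖fderiv ℝ K u‖ₑ ^ 2) < 1)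
    -- the dual proximal step uses either `σ_i` or the updated `σ_{i+1}`
    (s : ℕ → ℝ) (hs : s = NonlinearPD.stepσ μ σ₀ N ∨ s = fun i => NonlinearPD.stepσ μ σ₀ N (i + 1))
    -- uniform bounds on the preconditioners
    (θ Θ : ℝ) (hθ : 0 < θ) (hΘ : 0 < Θ)
    (hM : ∀ i : ℕ, ∀ b ∈ closedBall (0 : X) R, ∀ q : WithLp 2 (X × Y),
      θ ^ 2 * ‖q‖ ^ 2 ≤ inner ℝ (NonlinearPD.opM K (NonlinearPD.stepσ μ σ₀ N i)
          (NonlinearPD.stepτ μ σ₀ τ₀ N i) b q) q ∧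
      inner ℝ (NonlinearPD.opM K (NonlinearPD.stepσ μ σ₀ N i)
          (NonlinearPD.stepτ μ σ₀ τ₀ N i) b q) q ≤ Θ ^ 2 * ‖q‖ ^ 2)
    (κ : ℝ) (hκ : κ = Θ / θ)
    -- metric regularity and the smallness condition, read in `[0, ∞]`
    (hreg : NonlinearPD.IsMetricallyRegular (NonlinearPD.opH G F K qh.fst) 0 qh)
    (lip : ℝ≥0∞) (hlip : lip = NonlinearPD.lipInv (NonlinearPD.opH G F K qh.fst) 0 qh)
    (hsmall : lip * ENNReal.ofReal κ * L₂ * ‖qh.snd‖ₑ <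
      1 - 1 / (1 + 1 / (2 * lip ^ 2 * ENNReal.ofReal Θ ^ 4)) ^ (1 / 2 : ℝ)) :
    ∃ δ > (0 : ℝ), ∀ q₀ : WithLp 2 (X × Y), ‖q₀ - qh‖ ≤ δ →
      (∃ q : ℕ → WithLp 2 (X × Y), q 0 = q₀ ∧
        NonlinearPD.IsIterates G F K (NonlinearPD.stepτ μ σ₀ τ₀ N) s
          (NonlinearPD.stepω μ σ₀ N) q) ∧
      ∀ q : ℕ → WithLp 2 (X × Y), q 0 = q₀ →
        NonlinearPD.IsIterates G F K (NonlinearPD.stepτ μ σ₀ τ₀ N) s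
          (NonlinearPD.stepω μ σ₀ N) q →
        ∃ qs : WithLp 2 (X × Y), Tendsto q atTop (𝓝 qs) ∧
          NonlinearPD.IsCriticalPoint G F K qs := by
  have hR' : ‖qh‖ < R := by linarith
  have hτ := NonlinearPD.stepτ_pos (N := N) hμ.1 hσ₀ hτ₀
  have hσ := NonlinearPD.stepσ_pos (N := N) hμ.1 hσ₀
  have hs_pos : ∀ i, 0 < s i := by
    rcases hs with rfl | rfl
    · exact hσ
    · exact fun i => hσ (i + 1)
  have hs_add : ∀ i, s (i + N) = NonlinearPD.stepσ μ σ₀ N N := by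
    rcases hs with rfl | rfl
    · exact NonlinearPD.stepσ_add
    -- The shifted choice reads `σ` at `i + 1 + N`, which is constant too; before index `N` only
    -- positivity of `s` matters.
    · intro i
      have := NonlinearPD.stepσ_add (μ := μ) (σ₀ := σ₀) (N := N) (i + 1)
      rwa [Nat.succ_add] at this
  have hcrit : NonlinearPD.IsCriticalPoint G F K qh := NonlinearPD.zero_mem_opH_self_iff.1 hsol
  have hpre : NonlinearPD.IsPreconditioner (NonlinearPD.opMLin K (NonlinearPD.stepσ μ σ₀ N N)
      (NonlinearPD.stepτ μ σ₀ τ₀ N N) qh.fst) θ Θ := by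
    have hb : qh.fst ∈ closedBall (0 : X) R := by
      simpa using (NonlinearPD.norm_fst_le qh).trans hR'.le
    exact ⟨NonlinearPD.opMLin_isSymmetric _ _ _, hθ, hΘ, fun q => (hM N _ hb q).1,
      fun q => (hM N _ hb q).2⟩
  have hlip_top : lip ≠ ⊤ := by
    obtain ⟨-, ℓ, hℓ⟩ := hreg
    rw [hlip]
    exact ne_top_of_le_ne_top ENNReal.ofReal_ne_top (iInf₂_le ℓ hℓ)
  lift lip to ℝ≥0 using hlip_top
  have hsmall' := NonlinearPD.smallness_toReal (lip := lip) (a := L₂ * ‖qh.snd‖₊) (κ := κ)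
    (by rw [hκ]; positivity) hΘ (by
      rw [ENNReal.coe_mul, ← mul_assoc]
      exact hsmall)
  obtain ⟨ℓ₀, ℓ, hℓ₀, hℓ, hℓsmall⟩ := NonlinearPD.exists_isRegularityConstant_lt hlip
    (f := fun ℓ : ℝ => κ * ℓ * ((L₂ * ‖qh.snd‖₊ : ℝ≥0) : ℝ) +
      √(2 * (ℓ * Θ ^ 2) ^ 2 / (2 * (ℓ * Θ ^ 2) ^ 2 + 1)))
    (by
      have : ∀ ℓ : ℝ, 2 * (ℓ * Θ ^ 2) ^ 2 + 1 ≠ 0 := fun ℓ => by positivity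
      fun_prop (disch := assumption)) hsmall'
  rw [hκ] at hℓsmall
  obtain ⟨ρ, hρ, hconv⟩ := NonlinearPD.exists_radius_tendsto hG hF hK hK'.continuous hL₂ hR' hcrit
    (hτ N) (hσ N) hpre hℓ₀ hℓ hℓsmall
  obtain ⟨δ, hδ, hN⟩ := NonlinearPD.exists_radius_isIterates hG hF hK.continuous hK'.continuous
    (ω := NonlinearPD.stepω μ σ₀ N) hτ hs_pos hcrit N ρ hρ
  refine ⟨δ, hδ, fun q₀ hq₀ => ⟨NonlinearPD.exists_isIterates hG hF hτ hs_pos _ q₀,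
    fun q hq hit => ?_⟩⟩
  -- The tail from index `N` on is a run with constant step lengths.
  obtain ⟨qs, hqs, hcs⟩ := hconv (fun i => q (i + N))
    (by simpa using hN q hit (by rwa [hq])) fun i => by
      have h := hit.isStep (i + N)
      rwa [NonlinearPD.stepτ_add, hs_add, NonlinearPD.stepω_eq_one (Nat.le_add_left N i),
        Nat.add_right_comm] at h
  exact ⟨qs, (tendsto_add_atTop_iff_nat N).1 hqs, hcs⟩
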